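/- **Setting.** All manifolds are smooth, finite-dimensional, Hausdorff and second countable, and all maps, forms and vector fields are smooth. Let $\pi\colon E\to M$ be a fibred manifold (a surjective submersion) with $\dim M=m$, $\dim E=m+n$, and let $\eta$ be a volume form on $M$. Let $\pi^1\colon J^1\pi\to E$ be the first jet bundle, whose points over $u\in E$ are the linear right inverses $T_x\phi$ of $T_u\pi$ ($\phi$ a local section with $\phi(x)=u$), and put $\bar\pi^1=\pi\circ\pi^1$. Let $\Lambda^m_k(T^*E)$ be the bundle of $m$-covectors on $E$ that vanish when contracted with $k$ $\pi$-vertical vectors, let $J^1\pi^*=\Lambda^m_2(T^*E)/\Lambda^m_1(T^*E)$ with projections $\pi_E^r\colon J^1\pi^*\to E$, $\bar\pi_E^r=\pi\circ\pi_E^r$, and let $\mu\colon\Lambda^m_2(T^*E)\to J^1\pi^*$ be the quotient map. Sections are local sections, defined on open subsets of the base, except that $\Psi$, $s$, $h$ below are global. For a fibred manifold $\rho\colon P\to M$, a distribution $\mathcal D$ on $P$ is a subbundle of $TP$; it is $m$-dimensional if it has rank $m$, $\rho$-transverse if $\mathcal D_p\cap\ker T_p\rho=0$ for all $p$, and integrable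 if an $m$-dimensional integral manifold passes through every point. A section $\psi\colon U\to P$ of $\rho$ is an integral section of $\mathcal D$ if $\operatorname{Im}T_x\psi=\mathcal D_{\psi(x)}$ for all $x\in U$. The class $\{\mathcal X\}$ associated with $\mathcal D$ consists of the non-vanishing, locally decomposable $m$-multivector fields on $P$ that are sections of $\Lambda^m\mathcal D$. Let $\mathcal D$ be an $m$-dimensional, integrable and $\pi$-transverse distribution on $E$, with associated class $\{\mathcal X\}$. **Lagrangian part.** Let $L\in C^\infty(J^1\pi)$, let $\Theta_{\mathcal L}$ be the Cartan $m$-form of the Lagrangian density $\mathcal L=L\,(\bar\pi^1)^*\eta$, given in natural coordinates with $\eta=d^mx$ by $$\Theta_{\mathcal L}=\frac{\partial L}{\partial u^\alpha_i}\,(du^\alpha-u^\alpha_j\,dx^j)\wedge d^{m-1}x_i+L\,d^mx ,\qquad d^{m-1}x_i=i(\partial/\partial x^i)\,d^mx ,$$ and let $\Omega_{\mathcal L}=-d\Theta_{\mathcal L}$. Let $\mathcal D_{\mathcal L}$ be an $m$-dimensional, $\bar\pi^1$-transverse and integrable distribution on $J^1\pi$ whose integral sections are all prolongations $j^1\phi$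 of sections $\phi$ of $\pi$ satisfying $(j^1\phi)^*i(X)\Omega_{\mathcal L}=0$ for every vector field $X$ on $J^1\pi$, and let $\{\mathcal X_{\mathcal L}\}$ be its associated class. Let $\Psi$ be a section of $\pi^1$ (a jet field) such that, for every section $\gamma$ of $\pi$, $$\gamma\text{ is an integral section of }\mathcal D\ \Longrightarrow\ \Psi\circ\gamma\text{ is an integral section of }\mathcal D_{\mathcal L}.$$ Then for every $\mathcal X\in\{\mathcal X\}$ there is $\mathcal X_{\mathcal L}\in\{\mathcal X_{\mathcal L}\}$, satisfying $i(\mathcal X_{\mathcal L})\Omega_{\mathcal L}=0$, with $$\mathcal X=\Lambda^mT\pi^1\circ\mathcal X_{\mathcal L}\circ\Psi .$$ Moreover $\mathcal D_u=T_{\Psi(u)}\pi^1\big((\mathcal D_{\mathcal L})_{\Psi(u)}\big)$ for every $u\in E$; so $\mathcal D$ is determined by $\Psi$ and $\mathcal D_{\mathcal L}$. **Hamiltonian part.** Let $\Theta$ be the Liouville $m$-form on $\Lambda^m_2(T^*E)$ (at $(u,\beta)$ it is the pullback of $\beta$ along the projection to $E$), $\Omega=-d\Theta$, let $h$ be a section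 of $\mu$ and $\Omega_h=h^*\Omega$. Let $\mathcal D_h$ be an $m$-dimensional, $\bar\pi_E^r$-transverse and integrable distribution on $J^1\pi^*$ whose integral sections $\psi$ all satisfy $\psi^*i(X)\Omega_h=0$ for every vector field $X$ on $J^1\pi^*$, and let $\{\mathcal X_h\}$ be its associated class. Let $s$ be a section of $\pi_E^r$ such that, for every section $\gamma$ of $\pi$, $$\gamma\text{ is an integral section of }\mathcal D\ \Longrightarrow\ s\circ\gamma\text{ is an integral section of }\mathcal D_h.$$ Then for every $\mathcal X\in\{\mathcal X\}$ there is $\mathcal X_h\in\{\mathcal X_h\}$, satisfying $i(\mathcal X_h)\Omega_h=0$, with $$\mathcal X=\Lambda^mT\pi_E^r\circ\mathcal X_h\circ s ,$$ and $\mathcal D_u=T_{s(u)}\pi_E^r\big((\mathcal D_h)_{s(u)}\big)$ for every $u\in E$. -/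

import Mathlib

open scoped Manifold ContDiff

noncomputable section

open Set Function
open scoped Topology

namespace FieldHJ

/-- The model space `ℝᵏ`. -/
abbrev Euc (k : ℕ) : Type := EuclideanSpace ℝ (Fin k)

/-! ### Calculus lemmas for the smooth structures below -/

instance finiteDimensional_alternating {V : Type*} [NormedAddCommGroup V] [NormedSpace ℝ V]
    [FiniteDimensional ℝ V] (k : ℕ) : FiniteDimensional ℝ (V [⋀^Fin k]→L[ℝ] ℝ) := by
  let f : (V [⋀^Fin k]→L[ℝ] ℝ) →ₗ[ℝ] MultilinearMap ℝ (fun _ : Fin k => V) ℝ :=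
    { toFun := fun g => g.toContinuousMultilinearMap.toMultilinearMap
      map_add' := fun _ _ => rfl
      map_smul' := fun _ _ => rfl }
  refine FiniteDimensional.of_injective f fun a b h => ?_
  ext v
  exact congrArg (fun g : MultilinearMap ℝ (fun _ : Fin k => V) ℝ => g v) h

theorem contDiffOn_of_injective {X A B : Type*} [NormedAddCommGroup X] [NormedSpace ℝ X]
    [NormedAddCommGroup A] [NormedSpace ℝ A] [FiniteDimensional ℝ A]
    [NormedAddCommGroup B] [NormedSpace ℝ B]
    (ι : A →L[ℝ] B) (hι : Injective ι) {f : X → A} {s : Set X}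
    (h : ContDiffOn ℝ ∞ (fun x => ι (f x)) s) : ContDiffOn ℝ ∞ f s := by
  obtain ⟨r, hr⟩ := ι.toLinearMap.exists_leftInverse_of_injective (LinearMap.ker_eq_bot.2 hι)
  obtain ⟨P, hP⟩ := Submodule.ClosedComplemented.of_finiteDimensional (LinearMap.range ι.toLinearMap)
  let r' : LinearMap.range ι.toLinearMap →L[ℝ] A :=
    LinearMap.toContinuousLinearMap (r ∘ₗ (LinearMap.range ι.toLinearMap).subtype)
  have key : ∀ a, (r' ∘L P) (ι a) = a := fun a => by
    have h1 := hP ⟨ι a, ⟨a, rfl⟩⟩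
    simp only [ContinuousLinearMap.comp_apply]
    erw [h1]
    exact LinearMap.congr_fun hr a
  exact ((r' ∘L P).contDiff.comp_contDiffOn h).congr fun x _ => (key (f x)).symm

theorem contDiff_compContinuousLinearMap {V V' : Type*}
    [NormedAddCommGroup V] [NormedSpace ℝ V] [FiniteDimensional ℝ V]
    [NormedAddCommGroup V'] [NormedSpace ℝ V'] [FiniteDimensional ℝ V'] (k : ℕ) :
    ContDiff ℝ ∞ (fun p : (V' [⋀^Fin k]→L[ℝ] ℝ) × (V →L[ℝ] V') =>
      p.1.compContinuousLinearMap p.2) := by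
  rw [← contDiffOn_univ]
  refine contDiffOn_of_injective
    (ContinuousAlternatingMap.toContinuousMultilinearMapCLM ℝ)
    (fun a b h => ContinuousAlternatingMap.toContinuousMultilinearMap_injective h) ?_
  rw [contDiffOn_univ]
  have h1 : ContDiff ℝ ∞ (fun p : (V' [⋀^Fin k]→L[ℝ] ℝ) × (V →L[ℝ] V') =>
      ContinuousMultilinearMap.compContinuousLinearMapContinuousMultilinear ℝ
        (fun _ : Fin k => V) (fun _ => V') ℝ (fun _ => p.2)) :=
    (ContinuousMultilinearMap.contDiff _).comp (contDiff_pi.2 fun _ => contDiff_snd)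
  have h2 : ContDiff ℝ ∞ (fun p : (V' [⋀^Fin k]→L[ℝ] ℝ) × (V →L[ℝ] V') =>
      p.1.toContinuousMultilinearMap) :=
    (ContinuousAlternatingMap.toContinuousMultilinearMapCLM (𝕜 := ℝ) (E := V') (F := ℝ) (ι := Fin k)
      ℝ).contDiff.comp contDiff_fst
  exact h1.clm_apply h2

theorem contDiff_coe_snd {A X : Type*} [NormedAddCommGroup A] [NormedSpace ℝ A]
    [NormedAddCommGroup X] [NormedSpace ℝ X] (S : Submodule ℝ A) :
    ContDiff ℝ ∞ (fun q : X × S => (q.2 : A)) :=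
  S.subtypeL.contDiff.comp (contDiff_snd : ContDiff ℝ ∞ (Prod.snd : X × S → S))

/-- A linear projection of a finite-dimensional space onto a subspace. -/
def subspaceProj {A : Type*} [NormedAddCommGroup A] [NormedSpace ℝ A] [FiniteDimensional ℝ A]
    (S : Submodule ℝ A) (x : A) : S :=
  (Submodule.ClosedComplemented.of_finiteDimensional S).choose x

theorem contDiff_subspaceProj {A : Type*} [NormedAddCommGroup A] [NormedSpace ℝ A]
    [FiniteDimensional ℝ A] (S : Submodule ℝ A) : ContDiff ℝ ∞ (subspaceProj S) :=
  (Submodule.ClosedComplemented.of_finiteDimensional S).choose.contDiff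

theorem subspaceProj_coe {A : Type*} [NormedAddCommGroup A] [NormedSpace ℝ A]
    [FiniteDimensional ℝ A] (S : Submodule ℝ A) (x : S) : subspaceProj S x = x :=
  (Submodule.ClosedComplemented.of_finiteDimensional S).choose_spec x

theorem contDiffOn_pullback {V : Type*} [NormedAddCommGroup V] [NormedSpace ℝ V]
    [FiniteDimensional ℝ V] {k : ℕ} (S : Submodule ℝ (V [⋀^Fin k]→L[ℝ] ℝ)) {T : V → V →L[ℝ] V}
    {s : Set V} (hT : ContDiffOn ℝ ∞ T s) :
    ContDiffOn ℝ ∞ (fun q : V × S => (q.2 : V [⋀^Fin k]→L[ℝ] ℝ).compContinuousLinearMap (T q.1))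
      (s ×ˢ univ) := by
  have h2 : ContDiffOn ℝ ∞ (fun q : V × S => T q.1) (s ×ˢ univ) :=
    hT.comp contDiffOn_fst fun q hq => hq.1
  exact (contDiff_compContinuousLinearMap k).comp_contDiffOn
    ((contDiff_coe_snd S).contDiffOn.prodMk h2)

theorem contDiffOn_proj_pullback {V : Type*} [NormedAddCommGroup V] [NormedSpace ℝ V]
    [FiniteDimensional ℝ V] {k : ℕ} (S : Submodule ℝ (V [⋀^Fin k]→L[ℝ] ℝ)) {T : V → V →L[ℝ] V}
    {s : Set V} (hT : ContDiffOn ℝ ∞ T s) :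
    ContDiffOn ℝ ∞ (fun q : V × S =>
      subspaceProj S ((q.2 : V [⋀^Fin k]→L[ℝ] ℝ).compContinuousLinearMap (T q.1)))
      (s ×ˢ univ) :=
  (contDiff_subspaceProj S).comp_contDiffOn (contDiffOn_pullback S hT)

theorem contDiffOn_proj_pullback_sub {V : Type*} [NormedAddCommGroup V] [NormedSpace ℝ V]
    [FiniteDimensional ℝ V] {k : ℕ} (S : Submodule ℝ (V [⋀^Fin k]→L[ℝ] ℝ)) {T : V → V →L[ℝ] V}
    (P : V →L[ℝ] V) {s : Set V} (hT : ContDiffOn ℝ ∞ T s) :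
    ContDiffOn ℝ ∞ (fun q : V × S =>
      subspaceProj S ((q.2 : V [⋀^Fin k]→L[ℝ] ℝ).compContinuousLinearMap (T q.1) -
        ((q.2 : V [⋀^Fin k]→L[ℝ] ℝ).compContinuousLinearMap (T q.1)).compContinuousLinearMap P))
      (s ×ˢ univ) :=
  (contDiff_subspaceProj S).comp_contDiffOn ((contDiffOn_pullback S hT).sub
    ((contDiff_compContinuousLinearMap k).comp_contDiffOn
      ((contDiffOn_pullback S hT).prodMk contDiffOn_const)))

/-! ### Smooth structure on a family of fibres, glued from local trivialisations -/

/-- Local trivialisations of a family of sets `Z u`, `u : B`, with typical fibre `W`: for every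
`i : B` a chart `base i` of `B` around `i` and bijections `Z u ≃ W` for `u` in its domain,
with smooth changes of coordinates. -/
structure FibreCharts {B : Type*} [TopologicalSpace B] (V W : Type*) [NormedAddCommGroup V]
    [NormedSpace ℝ V] [NormedAddCommGroup W] [NormedSpace ℝ W] (Z : B → Type*) where
  base : B → OpenPartialHomeomorph B V
  mem_base : ∀ u, u ∈ (base u).source
  fib : ∀ i u, u ∈ (base i).source → (Z u ≃ W)
  smooth_base : ∀ i j, ContDiffOn ℝ ∞ (base j ∘ (base i).symm) ((base i).symm.trans (base j)).source
  smooth_fib : ∀ i j, ∃ g : V × W → W,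
    ContDiffOn ℝ ∞ g (((base i).symm.trans (base j)).source ×ˢ univ) ∧
    ∀ u (hi : u ∈ (base i).source) (hj : u ∈ (base j).source) (a : Z u),
      fib j u hj a = g (base i u, fib i u hi a)

namespace FibreCharts

variable {B : Type*} [TopologicalSpace B] {V W : Type*} [NormedAddCommGroup V]
  [NormedSpace ℝ V] [NormedAddCommGroup W] [NormedSpace ℝ W] {Z : B → Type*}
  (c : FibreCharts V W Z)

open Classical in
/-- The chart `(u, a) ↦ (base i u, fib i u a)` on the total space. -/
def chartFun (i : B) (p : Bundle.TotalSpace W Z) : V × W :=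
  if h : p.proj ∈ (c.base i).source then (c.base i p.proj, c.fib i p.proj h p.snd)
  else (c.base i p.proj, 0)

open Classical in
/-- The inverse of the chart `chartFun`. -/
def chartInv (i : B) (q : V × W) : Bundle.TotalSpace W Z :=
  if h : q.1 ∈ (c.base i).target then
    ⟨(c.base i).symm q.1, (c.fib i _ ((c.base i).map_target h)).symm q.2⟩
  else ⟨i, (c.fib i i (c.mem_base i)).symm 0⟩

theorem chartFun_mk (i : B) {u : B} (a : Z u) (h : u ∈ (c.base i).source) :
    c.chartFun i ⟨u, a⟩ = (c.base i u, c.fib i u h a) := dif_pos h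

theorem chartInv_mk (i : B) {z : V} (w : W) (h : z ∈ (c.base i).target) :
    c.chartInv i (z, w) = ⟨(c.base i).symm z, (c.fib i _ ((c.base i).map_target h)).symm w⟩ :=
  dif_pos h

/-- The chart of the total space over the domain of `base i`. -/
def chart (i : B) : PartialEquiv (Bundle.TotalSpace W Z) (V × W) where
  toFun := c.chartFun i
  invFun := c.chartInv i
  source := Bundle.TotalSpace.proj ⁻¹' (c.base i).source
  target := (c.base i).target ×ˢ univ
  map_source' := by
    rintro ⟨u, a⟩ (hp : u ∈ (c.base i).source)
    rw [chartFun_mk c i a hp]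
    exact ⟨(c.base i).map_source hp, trivial⟩
  map_target' := by
    rintro ⟨z, w⟩ ⟨hz, -⟩
    rw [chartInv_mk c i w hz]
    exact (c.base i).map_target hz
  left_inv' := by
    rintro ⟨u, a⟩ (hp : u ∈ (c.base i).source)
    rw [chartFun_mk c i a hp, chartInv_mk c i _ ((c.base i).map_source hp)]
    have hu := (c.base i).left_inv hp
    generalize_proofs h1
    revert h1
    rw [hu]
    intro h1
    simp
  right_inv' := by
    rintro ⟨z, w⟩ ⟨hz, -⟩
    rw [chartInv_mk c i w hz, chartFun_mk c i _ ((c.base i).map_target hz)]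
    simp [(c.base i).right_inv hz]

theorem chart_apply (i : B) {u : B} (a : Z u) (h : u ∈ (c.base i).source) :
    c.chart i ⟨u, a⟩ = (c.base i u, c.fib i u h a) := dif_pos h

theorem chart_symm_apply (i : B) {z : V} (w : W) (h : z ∈ (c.base i).target) :
    (c.chart i).symm (z, w) =
      ⟨(c.base i).symm z, (c.fib i _ ((c.base i).map_target h)).symm w⟩ := dif_pos h

theorem chart_trans_source (i j : B) : ((c.chart i).symm.trans (c.chart j)).source =
    ((c.base i).symm.trans (c.base j)).source ×ˢ univ := by
  ext ⟨z, w⟩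
  constructor
  · rintro ⟨⟨h1, -⟩, h2⟩
    have h1 : z ∈ (c.base i).target := h1
    have h2 : (c.chart i).symm (z, w) ∈ (c.chart j).source := h2
    rw [c.chart_symm_apply i w h1] at h2
    exact ⟨⟨h1, h2⟩, trivial⟩
  · rintro ⟨⟨h1, h2⟩, -⟩
    have h1 : z ∈ (c.base i).target := h1
    refine ⟨⟨h1, trivial⟩, ?_⟩
    change (c.chart i).symm (z, w) ∈ (c.chart j).source
    rw [c.chart_symm_apply i w h1]
    exact h2

theorem contDiffOn_chart_trans (i j : B) : ContDiffOn ℝ ∞ ((c.chart i).symm.trans (c.chart j))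
    ((c.chart i).symm.trans (c.chart j)).source := by
  rw [chart_trans_source]
  obtain ⟨g, hg, hgj⟩ := c.smooth_fib i j
  refine ContDiffOn.congr (f := fun q : V × W => ((c.base j ∘ (c.base i).symm) q.1, g q))
    (((c.smooth_base i j).comp contDiffOn_fst fun q hq => hq.1).prodMk hg) ?_
  rintro ⟨z, w⟩ ⟨⟨hz, hz'⟩, -⟩
  have hz : z ∈ (c.base i).target := hz
  have hz' : (c.base i).symm z ∈ (c.base j).source := hz'
  change c.chart j ((c.chart i).symm (z, w)) = _
  rw [c.chart_symm_apply i w hz, c.chart_apply j _ hz']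
  simp [hgj _ ((c.base i).map_target hz), (c.base i).right_inv hz]

/-- The charts `chart i` make the total space a manifold modelled on `V × W`. -/
def core : ChartedSpaceCore (V × W) (Bundle.TotalSpace W Z) where
  atlas := range c.chart
  chartAt p := c.chart p.proj
  mem_chart_source p := c.mem_base p.proj
  chart_mem_atlas p := ⟨_, rfl⟩
  open_source := by
    rintro _ _ ⟨i, rfl⟩ ⟨j, rfl⟩
    rw [chart_trans_source]
    exact (OpenPartialHomeomorph.open_source _).prod isOpen_univ
  continuousOn_toFun := by
    rintro _ _ ⟨i, rfl⟩ ⟨j, rfl⟩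
    exact (c.contDiffOn_chart_trans i j).continuousOn

theorem isManifold : let _ := c.core.toTopologicalSpace
    let _ := c.core.toChartedSpace
    IsManifold 𝓘(ℝ, V × W) ∞ (Bundle.TotalSpace W Z) := by
  let _ := c.core.toTopologicalSpace
  let _ := c.core.toChartedSpace
  refine isManifold_of_contDiffOn _ _ _ ?_
  rintro e e' he he'
  obtain ⟨_, ⟨_, rfl⟩, _, ⟨⟨i, rfl⟩, rfl⟩, he⟩ := he
  obtain ⟨_, ⟨_, rfl⟩, _, ⟨⟨j, rfl⟩, rfl⟩, he'⟩ := he'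
  rw [mem_singleton_iff] at he he'
  subst he he'
  have := c.contDiffOn_chart_trans i j
  simp only [modelWithCornersSelf_coe, modelWithCornersSelf_coe_symm, range_id, preimage_id,
    inter_univ]
  exact this

end FibreCharts

/-! ### Linear algebra of the fibres -/

section Linear

variable {X Y : Type*} [AddCommGroup X] [Module ℝ X] [TopologicalSpace X]
  [AddCommGroup Y] [Module ℝ Y] [TopologicalSpace Y]
  {V₁ V₂ : Type*} [NormedAddCommGroup V₁] [NormedSpace ℝ V₁]
  [NormedAddCommGroup V₂] [NormedSpace ℝ V₂]

/-- The `k`-forms on `X` that vanish whenever `r` of their arguments lie in the kernel of `p`. -/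
def semibasic (p : X →L[ℝ] Y) (r k : ℕ) : Submodule ℝ (X [⋀^Fin k]→L[ℝ] ℝ) where
  carrier := {β | ∀ (v : Fin k → X) (s : Finset (Fin k)), s.card = r → (∀ i ∈ s, p (v i) = 0) →
    β v = 0}
  add_mem' := fun ha hb v s hs hv => by
    simp [ha v s hs hv, hb v s hs hv]
  zero_mem' := fun v s hs hv => by simp
  smul_mem' := fun c a ha v s hs hv => by simp [ha v s hs hv]

variable {p : X →L[ℝ] Y} {k : ℕ}

/-- In linear coordinates adapted to `p`, right inverses of `p` are graphs of linear maps. -/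
def sectionEquiv (a : X ≃L[ℝ] V₁ × V₂) (b : Y ≃L[ℝ] V₁) (h : ∀ x, (a x).1 = b (p x)) :
    {A : Y →L[ℝ] X // p.comp A = ContinuousLinearMap.id ℝ Y} ≃ (V₁ →L[ℝ] V₂) where
  toFun A := (ContinuousLinearMap.snd ℝ V₁ V₂).comp
    ((a : X →L[ℝ] V₁ × V₂).comp (A.1.comp (b.symm : V₁ →L[ℝ] Y)))
  invFun B := ⟨(a.symm : V₁ × V₂ →L[ℝ] X).comp
      (((ContinuousLinearMap.id ℝ V₁).prod B).comp (b : Y →L[ℝ] V₁)), by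
    ext y
    apply b.injective
    simp [← h]⟩
  left_inv A := by
    ext y
    apply a.injective
    have h1 : p (A.1 y) = y := DFunLike.congr_fun A.2 y
    ext1
    · simp [h, h1]
    · simp
  right_inv B := by
    ext v
    simp

theorem sectionEquiv_change (a a' : X ≃L[ℝ] V₁ × V₂) (b b' : Y ≃L[ℝ] V₁)
    (h : ∀ x, (a x).1 = b (p x)) (h' : ∀ x, (a' x).1 = b' (p x))
    (T T' : V₁ × V₂ →L[ℝ] V₁ × V₂) (hT : ∀ x, T (a x) = a' x) (hT' : ∀ x, T' (a' x) = a x)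
    (A : {A : Y →L[ℝ] X // p.comp A = ContinuousLinearMap.id ℝ Y}) :
    sectionEquiv a' b' h' A = (ContinuousLinearMap.snd ℝ V₁ V₂).comp (T.comp
      (((ContinuousLinearMap.id ℝ V₁).prod (sectionEquiv a b h A)).comp
        ((ContinuousLinearMap.fst ℝ V₁ V₂).comp (T'.comp (ContinuousLinearMap.inl ℝ V₁ V₂))))) := by
  ext v
  obtain ⟨y, rfl⟩ := b'.surjective v
  have hA : ∀ y, p (A.1 y) = y := fun y => DFunLike.congr_fun A.2 y
  have h1 : (T' (b' y, 0)).1 = b y := by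
    obtain ⟨x, hx⟩ := a'.surjective (b' y, 0)
    have hx1 : b' (p x) = b' y := by rw [← h', hx]
    rw [← hx, hT', h, b'.injective hx1]
  have h2 : a (A.1 y) = (b y, (a (A.1 y)).2) := by
    ext1
    · simp [h, hA]
    · rfl
  simp [sectionEquiv, h1, ← h2, hT]

theorem comp_mem_semibasic {X' Y' : Type*} [AddCommGroup X'] [Module ℝ X'] [TopologicalSpace X']
    [AddCommGroup Y'] [Module ℝ Y'] [TopologicalSpace Y'] {p' : X' →L[ℝ] Y'} (T : X' →L[ℝ] X)
    (hT : ∀ x, p' x = 0 → p (T x) = 0) {r k : ℕ} {β : X [⋀^Fin k]→L[ℝ] ℝ}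
    (hβ : β ∈ semibasic p r k) : β.compContinuousLinearMap T ∈ semibasic p' r k :=
  fun v s hs hv => hβ (T ∘ v) s hs fun i hi => hT _ (hv i hi)

/-- Semibasic forms in linear coordinates adapted to `p`. -/
def semibasicEquiv (a : X ≃L[ℝ] V₁ × V₂) (b : Y ≃L[ℝ] V₁) (h : ∀ x, (a x).1 = b (p x)) (r k : ℕ) :
    semibasic p r k ≃ₗ[ℝ] semibasic (ContinuousLinearMap.fst ℝ V₁ V₂) r k where
  toFun β := ⟨β.1.compContinuousLinearMap (a.symm : V₁ × V₂ →L[ℝ] X),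
    comp_mem_semibasic _ (fun x hx => by
      apply b.injective
      rw [map_zero, ← h]
      simpa using hx) β.2⟩
  invFun β := ⟨β.1.compContinuousLinearMap (a : X →L[ℝ] V₁ × V₂),
    comp_mem_semibasic _ (fun x hx => by simp [h, hx]) β.2⟩
  map_add' _ _ := rfl
  map_smul' _ _ := rfl
  left_inv β := by
    ext v
    simp [Function.comp_def]
  right_inv β := by
    ext v
    simp [Function.comp_def]

variable (p k) in
/-- Two forms are identified if their difference lies in `semibasic p 1 k`. -/
def semibasicSetoid : Setoid (semibasic p 2 k) where
  r β γ := β.1 - γ.1 ∈ semibasic p 1 k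
  iseqv :=
    { refl := fun β => by simp
      symm := fun {β γ} h => by
        have := neg_mem h
        rwa [neg_sub] at this
      trans := fun {β γ δ} h h' => by
        have := add_mem h h'
        rwa [sub_add_sub_cancel] at this }

/-- The quotient of `semibasic p 2 k` by its subspace `semibasic p 1 k`. -/
def SemibasicQuotient (p : X →L[ℝ] Y) (k : ℕ) : Type _ := Quotient (semibasicSetoid p k)

/-- The class of a form in `SemibasicQuotient`. -/
def SemibasicQuotient.mk (β : semibasic p 2 k) : SemibasicQuotient p k :=
  Quotient.mk (semibasicSetoid p k) β

variable (V₁ V₂) in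
/-- The projection `(v, w) ↦ (v, 0)`. -/
def horProj : V₁ × V₂ →L[ℝ] V₁ × V₂ :=
  (ContinuousLinearMap.inl ℝ V₁ V₂).comp (ContinuousLinearMap.fst ℝ V₁ V₂)

variable (V₁ V₂ k) in
/-- The forms in `semibasic 2 k` without horizontal component; they represent each class modulo
`semibasic 1 k` exactly once. -/
def verticalForms : Submodule ℝ ((V₁ × V₂) [⋀^Fin k]→L[ℝ] ℝ) where
  carrier := {β | β ∈ semibasic (ContinuousLinearMap.fst ℝ V₁ V₂) 2 k ∧
    β.compContinuousLinearMap (horProj V₁ V₂) = 0}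
  add_mem' := fun ha hb => ⟨add_mem ha.1 hb.1, by
    ext v
    have h1 := DFunLike.congr_fun ha.2 v
    have h2 := DFunLike.congr_fun hb.2 v
    simp only [ContinuousAlternatingMap.compContinuousLinearMap_apply,
      ContinuousAlternatingMap.coe_zero, Pi.zero_apply] at h1 h2
    simp [h1, h2]⟩
  zero_mem' := ⟨zero_mem _, rfl⟩
  smul_mem' := fun c a ha => ⟨Submodule.smul_mem _ c ha.1, by
    ext v
    have h1 := DFunLike.congr_fun ha.2 v
    simp only [ContinuousAlternatingMap.compContinuousLinearMap_apply,
      ContinuousAlternatingMap.coe_zero, Pi.zero_apply] at h1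
    simp [h1]⟩

theorem horProj_comp_mem_one (β : (V₁ × V₂) [⋀^Fin k]→L[ℝ] ℝ) :
    β.compContinuousLinearMap (horProj V₁ V₂) ∈
      semibasic (ContinuousLinearMap.fst ℝ V₁ V₂) 1 k := by
  intro v s hs hv
  obtain ⟨i, rfl⟩ := Finset.card_eq_one.1 hs
  have h1 : (v i).1 = 0 := hv i (Finset.mem_singleton_self i)
  exact β.map_coord_zero i (by simp [horProj, h1])

theorem semibasic_one_le_two : semibasic p 1 k ≤ semibasic p 2 k := by
  intro β hβ v s hs hv
  obtain ⟨i, j, hij, rfl⟩ := Finset.card_eq_two.1 hs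
  exact hβ v {i} (Finset.card_singleton i) fun l hl => hv l (by simp_all)

theorem eq_horProj_of_mem_one {β : (V₁ × V₂) [⋀^Fin k]→L[ℝ] ℝ}
    (hβ : β ∈ semibasic (ContinuousLinearMap.fst ℝ V₁ V₂) 1 k) :
    β.compContinuousLinearMap (horProj V₁ V₂) = β := by
  ext v
  have key : ∀ s : Finset (Fin k),
      β (s.piecewise (horProj V₁ V₂ ∘ v) v) = β v := by
    intro s
    induction s using Finset.induction_on with
    | empty => simp
    | insert i s hi ih =>
      rw [← ih, Finset.piecewise_insert, ← sub_eq_zero]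
      have h2 : s.piecewise (horProj V₁ V₂ ∘ v) v = update (s.piecewise (horProj V₁ V₂ ∘ v) v) i
          (v i) := by
        rw [eq_comm, update_eq_self_iff, Finset.piecewise_eq_of_notMem _ _ _ hi]
      conv_lhs => rw [h2]
      rw [update_idem, ← ContinuousAlternatingMap.map_update_sub]
      refine hβ _ {i} (Finset.card_singleton i) fun l hl => ?_
      rw [Finset.mem_singleton.1 hl]
      simp [horProj]
  have := key Finset.univ
  rw [Finset.piecewise_univ] at this
  exact this

variable (V₁ V₂ k) in
/-- Removal of the horizontal component. -/
def removeHor (β : semibasic (ContinuousLinearMap.fst ℝ V₁ V₂) 2 k) : verticalForms V₁ V₂ k :=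
  ⟨β.1 - β.1.compContinuousLinearMap (horProj V₁ V₂),
    sub_mem β.2 (semibasic_one_le_two (horProj_comp_mem_one _)), by
      ext v
      simp [horProj, Function.comp_def]⟩

theorem removeHor_eq_iff (β γ : semibasic (ContinuousLinearMap.fst ℝ V₁ V₂) 2 k) :
    removeHor V₁ V₂ k β = removeHor V₁ V₂ k γ ↔
      β.1 - γ.1 ∈ semibasic (ContinuousLinearMap.fst ℝ V₁ V₂) 1 k := by
  have e : ∀ v, (β.1 - γ.1).compContinuousLinearMap (horProj V₁ V₂) v =
      β.1.compContinuousLinearMap (horProj V₁ V₂) v -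
      γ.1.compContinuousLinearMap (horProj V₁ V₂) v := fun v => rfl
  constructor
  · intro h
    have h1 := congrArg Subtype.val h
    have h2 : β.1 - γ.1 = (β.1 - γ.1).compContinuousLinearMap (horProj V₁ V₂) := by
      ext v
      have h3 := DFunLike.congr_fun h1 v
      rw [e]
      simp only [removeHor, ContinuousAlternatingMap.sub_apply] at h3 ⊢
      linarith
    rw [h2]
    exact horProj_comp_mem_one _
  · intro h
    have h1 := eq_horProj_of_mem_one h
    apply Subtype.ext
    ext v
    have h3 := DFunLike.congr_fun h1 v
    rw [e] at h3
    simp only [removeHor, ContinuousAlternatingMap.sub_apply] at h3 ⊢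
    linarith

/-- Classes of semibasic forms in linear coordinates adapted to `p`. -/
def semibasicQuotientEquiv (a : X ≃L[ℝ] V₁ × V₂) (b : Y ≃L[ℝ] V₁)
    (h : ∀ x, (a x).1 = b (p x)) (k : ℕ) :
    SemibasicQuotient p k ≃ verticalForms V₁ V₂ k where
  toFun := Quotient.lift (fun β => removeHor V₁ V₂ k (semibasicEquiv a b h 2 k β))
    fun β γ hr => (removeHor_eq_iff _ _).2 (semibasicEquiv a b h 1 k ⟨β.1 - γ.1, hr⟩).2
  invFun δ := SemibasicQuotient.mk ((semibasicEquiv a b h 2 k).symm ⟨δ.1, δ.2.1⟩)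
  left_inv := by
    refine Quotient.ind fun β => Quotient.sound ?_
    have h1 := horProj_comp_mem_one (V₁ := V₁) (V₂ := V₂) (semibasicEquiv a b h 2 k β).1
    have h2 := ((semibasicEquiv a b h 1 k).symm ⟨_, neg_mem h1⟩).2
    change _ ∈ semibasic p 1 k
    convert h2 using 1
    have h3 := congrArg Subtype.val ((semibasicEquiv a b h 2 k).symm_apply_apply β)
    ext v
    have h4 := DFunLike.congr_fun h3 v
    change (semibasicEquiv a b h 2 k β).1 (a ∘ v) -
      (semibasicEquiv a b h 2 k β).1 (horProj V₁ V₂ ∘ a ∘ v) - β.1 v =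
      -(semibasicEquiv a b h 2 k β).1 (horProj V₁ V₂ ∘ a ∘ v)
    have h5 : (semibasicEquiv a b h 2 k β).1 (a ∘ v) = β.1 v := h4
    rw [h5]
    ring
  right_inv := by
    intro δ
    apply Subtype.ext
    change ((semibasicEquiv a b h 2 k) ((semibasicEquiv a b h 2 k).symm ⟨δ.1, δ.2.1⟩)).1 -
      ((semibasicEquiv a b h 2 k)
        ((semibasicEquiv a b h 2 k).symm ⟨δ.1, δ.2.1⟩)).1.compContinuousLinearMap
          (horProj V₁ V₂) = δ.1
    rw [LinearEquiv.apply_symm_apply]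
    change δ.1 - δ.1.compContinuousLinearMap (horProj V₁ V₂) = δ.1
    rw [δ.2.2, sub_zero]

theorem semibasicQuotientEquiv_mk (a : X ≃L[ℝ] V₁ × V₂) (b : Y ≃L[ℝ] V₁)
    (h : ∀ x, (a x).1 = b (p x)) (k : ℕ) (β : semibasic p 2 k) :
    semibasicQuotientEquiv a b h k (SemibasicQuotient.mk β) =
      removeHor V₁ V₂ k (semibasicEquiv a b h 2 k β) := rfl

end Linear

/-! ### Fibred manifolds and their adapted charts -/

/-- `π : E → M` is a fibred manifold with `dim M = m` and `dim E = m + n`: a surjective smooth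
submersion. In particular every smooth fibre bundle is one. -/
class IsFibredManifold (m n : ℕ) {M E : Type*} [TopologicalSpace M] [ChartedSpace (Euc m) M]
    [TopologicalSpace E] [ChartedSpace (Euc (m + n)) E] (π : E → M) : Prop where
  surjective : Surjective π
  submersion : Manifold.IsSubmersionOfComplement (Euc n) (𝓡 (m + n)) (𝓡 m) ∞ π

section Adapted

variable (m n : ℕ) {M E : Type*} [TopologicalSpace M] [ChartedSpace (Euc m) M]
  [TopologicalSpace E] [ChartedSpace (Euc (m + n)) E] (π : E → M) [hπ : IsFibredManifold m n π]

/-- Coordinates `(x, y)` on `E` around `i`, adapted to `π`. -/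
def adapted (i : E) : OpenPartialHomeomorph E (Euc m × Euc n) :=
  (hπ.submersion i).domChart.transHomeomorph (hπ.submersion i).equiv.toHomeomorph

/-- The coordinates `x` on `M` underlying `adapted i`. -/
def adaptedBase (i : E) : OpenPartialHomeomorph M (Euc m) := (hπ.submersion i).codChart

theorem mem_adapted (i : E) : i ∈ (adapted m n π i).source :=
  (hπ.submersion i).mem_domChart_source

theorem map_adapted {i u : E} (hu : u ∈ (adapted m n π i).source) :
    π u ∈ (adaptedBase m n π i).source :=
  (hπ.submersion i).source_subset_preimage_source hu

theorem fst_adapted {i u : E} (hu : u ∈ (adapted m n π i).source) :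
    (adapted m n π i u).1 = adaptedBase m n π i (π u) := by
  have hu' : u ∈ (hπ.submersion i).domChart.source := hu
  have ht : (hπ.submersion i).domChart u ∈
      ((hπ.submersion i).domChart.extend (𝓡 (m + n))).target := by
    simpa using (hπ.submersion i).domChart.map_source hu'
  have h := (hπ.submersion i).writtenInCharts ht
  simp only [Function.comp_apply, OpenPartialHomeomorph.extend_coe,
    OpenPartialHomeomorph.extend_coe_symm, modelWithCornersSelf_coe,
    modelWithCornersSelf_coe_symm, id] at h
  rw [OpenPartialHomeomorph.left_inv _ hu'] at h
  exact h.symm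

theorem contMDiffOn_adapted (i : E) : ContMDiffOn (𝓡 (m + n)) 𝓘(ℝ, Euc m × Euc n) ∞
    (adapted m n π i) (adapted m n π i).source :=
  (hπ.submersion i).equiv.contDiff.contMDiff.comp_contMDiffOn
    (contMDiffOn_of_mem_maximalAtlas (hπ.submersion i).domChart_mem_maximalAtlas)

theorem contMDiffOn_adapted_symm (i : E) : ContMDiffOn 𝓘(ℝ, Euc m × Euc n) (𝓡 (m + n)) ∞
    (adapted m n π i).symm (adapted m n π i).target :=
  (contMDiffOn_symm_of_mem_maximalAtlas (hπ.submersion i).domChart_mem_maximalAtlas).comp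
    (hπ.submersion i).equiv.symm.contDiff.contMDiff.contMDiffOn fun _ hz => hz

theorem mdifferentiable_adapted (i : E) :
    (adapted m n π i).MDifferentiable (𝓡 (m + n)) 𝓘(ℝ, Euc m × Euc n) :=
  ⟨(contMDiffOn_adapted m n π i).mdifferentiableOn (by simp),
    (contMDiffOn_adapted_symm m n π i).mdifferentiableOn (by simp)⟩

theorem mdifferentiable_adaptedBase (i : E) :
    (adaptedBase m n π i).MDifferentiable (𝓡 m) (𝓡 m) :=
  ⟨(contMDiffOn_of_mem_maximalAtlas
      (hπ.submersion i).codChart_mem_maximalAtlas).mdifferentiableOn (by simp),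
    (contMDiffOn_symm_of_mem_maximalAtlas
      (hπ.submersion i).codChart_mem_maximalAtlas).mdifferentiableOn (by simp)⟩

/-- The differential of `adapted i` at `u`. -/
def dAdapted (i u : E) (hu : u ∈ (adapted m n π i).source) :
    TangentSpace (𝓡 (m + n)) u ≃L[ℝ] Euc m × Euc n :=
  (mdifferentiable_adapted m n π i).mfderiv hu

/-- The differential of `adaptedBase i` at `π u`. -/
def dAdaptedBase (i u : E) (hu : u ∈ (adapted m n π i).source) :
    TangentSpace (𝓡 m) (π u) ≃L[ℝ] Euc m :=
  (mdifferentiable_adaptedBase m n π i).mfderiv (map_adapted m n π hu)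

theorem mdifferentiable_proj : MDifferentiable (𝓡 (m + n)) (𝓡 m) π := fun u =>
  (hπ.submersion u).contMDiffAt.mdifferentiableAt (by simp)

theorem fst_dAdapted (i u : E) (hu : u ∈ (adapted m n π i).source)
    (v : TangentSpace (𝓡 (m + n)) u) :
    (dAdapted m n π i u hu v).1 =
      dAdaptedBase m n π i u hu (mfderiv (𝓡 (m + n)) (𝓡 m) π u v) := by
  have h1 : HasMFDerivAt (𝓡 (m + n)) 𝓘(ℝ, Euc m) (fun w => (adapted m n π i w).1) u
      ((ContinuousLinearMap.fst ℝ (Euc m) (Euc n)).comp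
        (mfderiv (𝓡 (m + n)) 𝓘(ℝ, Euc m × Euc n) (adapted m n π i) u)) :=
    (ContinuousLinearMap.fst ℝ (Euc m) (Euc n)).hasMFDerivAt.comp u
      ((mdifferentiable_adapted m n π i).mdifferentiableAt hu).hasMFDerivAt
  have h2 : HasMFDerivAt (𝓡 (m + n)) 𝓘(ℝ, Euc m) (adaptedBase m n π i ∘ π) u
      ((mfderiv (𝓡 m) (𝓡 m) (adaptedBase m n π i) (π u)).comp
        (mfderiv (𝓡 (m + n)) (𝓡 m) π u)) :=
    ((mdifferentiable_adaptedBase m n π i).mdifferentiableAt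
      (map_adapted m n π hu)).hasMFDerivAt.comp u (mdifferentiable_proj m n π u).hasMFDerivAt
  have h3 : (fun w => (adapted m n π i w).1) =ᶠ[𝓝 u] adaptedBase m n π i ∘ π :=
    Filter.eventuallyEq_of_mem ((adapted m n π i).open_source.mem_nhds hu)
      fun w hw => fst_adapted m n π hw
  have h4 := hasMFDerivAt_unique h1 (h2.congr_of_eventuallyEq h3)
  exact DFunLike.congr_fun h4 v

/-- The change of adapted coordinates. -/
def adaptedChange (i j : E) : Euc m × Euc n → Euc m × Euc n :=
  adapted m n π j ∘ (adapted m n π i).symm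

theorem contDiffOn_adaptedChange (i j : E) : ContDiffOn ℝ ∞ (adaptedChange m n π i j)
    ((adapted m n π i).symm.trans (adapted m n π j)).source := by
  rw [← contMDiffOn_iff_contDiffOn]
  exact (contMDiffOn_adapted m n π j).comp
    ((contMDiffOn_adapted_symm m n π i).mono fun z hz => hz.1) fun z hz => hz.2

theorem contDiffOn_fderiv_adaptedChange (i j : E) :
    ContDiffOn ℝ ∞ (fderiv ℝ (adaptedChange m n π i j))
      ((adapted m n π i).symm.trans (adapted m n π j)).source :=
  (contDiffOn_adaptedChange m n π i j).fderiv_of_isOpen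
    (OpenPartialHomeomorph.open_source _) (by simp)

theorem contDiffOn_fderiv_adaptedChange' (i j : E) :
    ContDiffOn ℝ ∞ (fun z => fderiv ℝ (adaptedChange m n π j i) (adaptedChange m n π i j z))
      ((adapted m n π i).symm.trans (adapted m n π j)).source := by
  refine (contDiffOn_fderiv_adaptedChange m n π j i).comp (contDiffOn_adaptedChange m n π i j) ?_
  rintro z ⟨hz, hz'⟩
  have hz' : (adapted m n π i).symm z ∈ (adapted m n π j).source := hz'
  refine ⟨(adapted m n π j).map_source hz', ?_⟩
  change (adapted m n π j).symm (adapted m n π j ((adapted m n π i).symm z)) ∈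
    (adapted m n π i).source
  rw [(adapted m n π j).left_inv hz']
  exact (adapted m n π i).map_target hz

theorem fderiv_adaptedChange (i j u : E) (hi : u ∈ (adapted m n π i).source)
    (hj : u ∈ (adapted m n π j).source) (v : TangentSpace (𝓡 (m + n)) u) :
    fderiv ℝ (adaptedChange m n π i j) (adapted m n π i u) (dAdapted m n π i u hi v) =
      dAdapted m n π j u hj v := by
  have hz : adapted m n π i u ∈ ((adapted m n π i).symm.trans (adapted m n π j)).source :=
    ⟨(adapted m n π i).map_source hi, by
      change (adapted m n π i).symm (adapted m n π i u) ∈ (adapted m n π j).source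
      rwa [(adapted m n π i).left_inv hi]⟩
  have h0 : DifferentiableAt ℝ (adaptedChange m n π i j) (adapted m n π i u) :=
    ((contDiffOn_adaptedChange m n π i j).contDiffAt
      ((OpenPartialHomeomorph.open_source _).mem_nhds hz)).differentiableAt (by simp)
  have h1 : HasMFDerivAt (𝓡 (m + n)) 𝓘(ℝ, Euc m × Euc n)
      (adaptedChange m n π i j ∘ adapted m n π i) u
      ((fderiv ℝ (adaptedChange m n π i j) (adapted m n π i u)).comp
        (mfderiv (𝓡 (m + n)) 𝓘(ℝ, Euc m × Euc n) (adapted m n π i) u)) :=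
    h0.hasFDerivAt.hasMFDerivAt.comp u
      ((mdifferentiable_adapted m n π i).mdifferentiableAt hi).hasMFDerivAt
  have h2 := ((mdifferentiable_adapted m n π j).mdifferentiableAt hj).hasMFDerivAt
  have h3 : adaptedChange m n π i j ∘ adapted m n π i =ᶠ[𝓝 u] adapted m n π j :=
    Filter.eventuallyEq_of_mem ((adapted m n π i).open_source.mem_nhds hi) fun w hw => by
      simp [adaptedChange, (adapted m n π i).left_inv hw]
  have h4 := hasMFDerivAt_unique h1 (h2.congr_of_eventuallyEq h3)
  exact DFunLike.congr_fun h4 v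

end Adapted

/-! ### The first jet bundle and the multimomentum bundles as smooth manifolds -/

section Bundles

variable (m n : ℕ) {M E : Type*} [TopologicalSpace M] [ChartedSpace (Euc m) M]
  [TopologicalSpace E] [ChartedSpace (Euc (m + n)) E] (π : E → M)

/-- The fibre of the first jet bundle over `u`: the jet at `x = π u` of a local section `φ` with
`φ x = u` is encoded by its differential `T_x φ`, a right inverse of `T_u π`. -/
abbrev JetFibre (u : E) : Type :=
  {A : TangentSpace (𝓡 m) (π u) →L[ℝ] TangentSpace (𝓡 (m + n)) u //
    (mfderiv (𝓡 (m + n)) (𝓡 m) π u).comp A = ContinuousLinearMap.id ℝ _}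

/-- The fibre over `u` of the extended dual jet bundle: the `m`-forms on `T_u E` that vanish
whenever two of their arguments are vertical. -/
abbrev ExtDualFibre (u : E) : Type := semibasic (mfderiv (𝓡 (m + n)) (𝓡 m) π u) 2 m

/-- The fibre over `u` of the reduced dual jet bundle: the quotient of `ExtDualFibre` by the
`m`-forms that vanish whenever one of their arguments is vertical. -/
abbrev DualFibre (u : E) : Type := SemibasicQuotient (mfderiv (𝓡 (m + n)) (𝓡 m) π u) m

/-- Typical fibre of the first jet bundle (coordinates `u_i^α`). -/
abbrev JetModel : Type := Euc m →L[ℝ] Euc n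

/-- Typical fibre of the extended dual jet bundle (coordinates `p`, `p_α^i`). -/
abbrev ExtDualModel : Type := semibasic (ContinuousLinearMap.fst ℝ (Euc m) (Euc n)) 2 m

/-- Typical fibre of the reduced dual jet bundle (coordinates `p_α^i`). -/
abbrev DualModel : Type := verticalForms (Euc m) (Euc n) m

/-- The first jet bundle `J¹π`. -/
def Jet : Type _ := Bundle.TotalSpace (JetModel m n) (JetFibre m n π)

/-- The extended dual jet bundle `Λ₂ᵐ(T*E)`. -/
def ExtDual : Type _ := Bundle.TotalSpace (ExtDualModel m n) (ExtDualFibre m n π)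

/-- The reduced dual jet bundle `J¹π* = Λ₂ᵐ(T*E) / Λ₁ᵐ(T*E)`. -/
def Dual : Type _ := Bundle.TotalSpace (DualModel m n) (DualFibre m n π)

variable [hπ : IsFibredManifold m n π]

/-- Natural coordinates on `J¹π`. -/
def jetCharts : FibreCharts (Euc m × Euc n) (JetModel m n) (JetFibre m n π) where
  base := adapted m n π
  mem_base := mem_adapted m n π
  fib i u hu := sectionEquiv (dAdapted m n π i u hu) (dAdaptedBase m n π i u hu)
    (fst_dAdapted m n π i u hu)
  smooth_base := contDiffOn_adaptedChange m n π
  smooth_fib i j := by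
    refine ⟨fun q => (ContinuousLinearMap.snd ℝ (Euc m) (Euc n)).comp
      ((fderiv ℝ (adaptedChange m n π i j) q.1).comp
        (((ContinuousLinearMap.id ℝ (Euc m)).prod q.2).comp
          ((ContinuousLinearMap.fst ℝ (Euc m) (Euc n)).comp
            ((fderiv ℝ (adaptedChange m n π j i) (adaptedChange m n π i j q.1)).comp
              (ContinuousLinearMap.inl ℝ (Euc m) (Euc n)))))), ?_, ?_⟩
    · have h1 := (contDiffOn_fderiv_adaptedChange m n π i j).comp
        (contDiffOn_fst (F := JetModel m n) (s := ((adapted m n π i).symm.trans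
          (adapted m n π j)).source ×ˢ (univ : Set (JetModel m n)))) fun q hq => hq.1
      have h2 := (contDiffOn_fderiv_adaptedChange' m n π i j).comp
        (contDiffOn_fst (F := JetModel m n) (s := ((adapted m n π i).symm.trans
          (adapted m n π j)).source ×ˢ (univ : Set (JetModel m n)))) fun q hq => hq.1
      have h3 : ContDiff ℝ ∞ (fun B : JetModel m n =>
          (ContinuousLinearMap.id ℝ (Euc m)).prod B) := by
        have h4 : (fun B : JetModel m n => (ContinuousLinearMap.id ℝ (Euc m)).prod B) =
            fun B => (ContinuousLinearMap.inl ℝ (Euc m) (Euc n)) +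
              (ContinuousLinearMap.inr ℝ (Euc m) (Euc n)).comp B := by
          funext B
          ext v <;> simp
        rw [h4]
        exact contDiff_const.add (contDiff_const.clm_comp contDiff_id)
      exact contDiffOn_const.clm_comp (h1.clm_comp ((h3.comp contDiff_snd).contDiffOn.clm_comp
        (contDiffOn_const.clm_comp (h2.clm_comp contDiffOn_const))))
    · intro u hi hj A
      refine sectionEquiv_change _ _ _ _ _ _ _ _ (fderiv_adaptedChange m n π i j u hi hj)
        (fun v => ?_) A
      have h1 : adaptedChange m n π i j (adapted m n π i u) = adapted m n π j u := by
        simp [adaptedChange, (adapted m n π i).left_inv hi]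
      rw [h1]
      exact fderiv_adaptedChange m n π j i u hj hi v

theorem semibasicEquiv_change (i j u : E) (hi : u ∈ (adapted m n π i).source)
    (hj : u ∈ (adapted m n π j).source) (β : ExtDualFibre m n π u) :
    (semibasicEquiv (dAdapted m n π j u hj) (dAdaptedBase m n π j u hj)
      (fst_dAdapted m n π j u hj) 2 m β).1 =
    (semibasicEquiv (dAdapted m n π i u hi) (dAdaptedBase m n π i u hi)
      (fst_dAdapted m n π i u hi) 2 m β).1.compContinuousLinearMap
      (fderiv ℝ (adaptedChange m n π j i) (adaptedChange m n π i j (adapted m n π i u))) := by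
  have h1 : adaptedChange m n π i j (adapted m n π i u) = adapted m n π j u := by
    simp [adaptedChange, (adapted m n π i).left_inv hi]
  rw [h1]
  ext v
  change β.1 (fun k => (dAdapted m n π j u hj).symm (v k)) =
    β.1 (fun k => (dAdapted m n π i u hi).symm
      (fderiv ℝ (adaptedChange m n π j i) (adapted m n π j u) (v k)))
  congr 1
  funext k
  obtain ⟨w, hw⟩ := (dAdapted m n π j u hj).surjective (v k)
  rw [← hw, fderiv_adaptedChange m n π j i u hj hi w]
  simp

theorem extDual_change (i j u : E) (hi : u ∈ (adapted m n π i).source)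
    (hj : u ∈ (adapted m n π j).source) (β : ExtDualFibre m n π u) :
    semibasicEquiv (dAdapted m n π j u hj) (dAdaptedBase m n π j u hj)
      (fst_dAdapted m n π j u hj) 2 m β =
    subspaceProj _ ((semibasicEquiv (dAdapted m n π i u hi) (dAdaptedBase m n π i u hi)
      (fst_dAdapted m n π i u hi) 2 m β).1.compContinuousLinearMap
      (fderiv ℝ (adaptedChange m n π j i) (adaptedChange m n π i j (adapted m n π i u)))) := by
  rw [← semibasicEquiv_change m n π i j u hi hj β, subspaceProj_coe]

/-- Natural coordinates on `Λ₂ᵐ(T*E)`. -/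
def extDualCharts : FibreCharts (Euc m × Euc n) (ExtDualModel m n) (ExtDualFibre m n π) where
  base := adapted m n π
  mem_base := mem_adapted m n π
  fib i u hu := (semibasicEquiv (dAdapted m n π i u hu) (dAdaptedBase m n π i u hu)
    (fst_dAdapted m n π i u hu) 2 m).toEquiv
  smooth_base := contDiffOn_adaptedChange m n π
  smooth_fib i j := ⟨_, contDiffOn_proj_pullback _ (contDiffOn_fderiv_adaptedChange' m n π i j),
    extDual_change m n π i j⟩

theorem dual_change (i j u : E) (hi : u ∈ (adapted m n π i).source)
    (hj : u ∈ (adapted m n π j).source) (q : DualFibre m n π u) :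
    semibasicQuotientEquiv (dAdapted m n π j u hj) (dAdaptedBase m n π j u hj)
      (fst_dAdapted m n π j u hj) m q =
    subspaceProj _ ((semibasicQuotientEquiv (dAdapted m n π i u hi) (dAdaptedBase m n π i u hi)
      (fst_dAdapted m n π i u hi) m q).1.compContinuousLinearMap
      (fderiv ℝ (adaptedChange m n π j i) (adaptedChange m n π i j (adapted m n π i u))) -
      ((semibasicQuotientEquiv (dAdapted m n π i u hi) (dAdaptedBase m n π i u hi)
      (fst_dAdapted m n π i u hi) m q).1.compContinuousLinearMap
      (fderiv ℝ (adaptedChange m n π j i)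
        (adaptedChange m n π i j (adapted m n π i u)))).compContinuousLinearMap
        (horProj (Euc m) (Euc n))) := by
  refine Quotient.inductionOn q fun β => ?_
  have h := semibasicEquiv_change m n π i j u hi hj β
  set βi := semibasicEquiv (dAdapted m n π i u hi) (dAdaptedBase m n π i u hi)
    (fst_dAdapted m n π i u hi) 2 m β with hβi
  set βj := semibasicEquiv (dAdapted m n π j u hj) (dAdaptedBase m n π j u hj)
    (fst_dAdapted m n π j u hj) 2 m β with hβj
  set T := fderiv ℝ (adaptedChange m n π j i) (adaptedChange m n π i j (adapted m n π i u))
    with hT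
  have h1 : adaptedChange m n π i j (adapted m n π i u) = adapted m n π j u := by
    simp [adaptedChange, (adapted m n π i).left_inv hi]
  have hvert : ∀ x : Euc m × Euc n, ContinuousLinearMap.fst ℝ (Euc m) (Euc n) x = 0 →
      ContinuousLinearMap.fst ℝ (Euc m) (Euc n) (T x) = 0 := by
    intro x hx
    obtain ⟨w, rfl⟩ := (dAdapted m n π j u hj).surjective x
    rw [hT, h1, fderiv_adaptedChange m n π j i u hj hi w]
    change (dAdapted m n π i u hi w).1 = 0
    have hx : (dAdapted m n π j u hj w).1 = 0 := hx
    rw [fst_dAdapted] at hx ⊢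
    rw [(dAdaptedBase m n π j u hj).map_eq_zero_iff.1 hx, map_zero]
  have h2 := eq_horProj_of_mem_one (comp_mem_semibasic T hvert (horProj_comp_mem_one βi.1))
  have h3 : (removeHor (Euc m) (Euc n) m βi).1.compContinuousLinearMap T -
      ((removeHor (Euc m) (Euc n) m βi).1.compContinuousLinearMap T).compContinuousLinearMap
        (horProj (Euc m) (Euc n)) = (removeHor (Euc m) (Euc n) m βj).1 := by
    ext v
    have h4 := DFunLike.congr_fun h2 v
    change (βi.1 (T ∘ v) - βi.1 (horProj _ _ ∘ T ∘ v)) -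
      (βi.1 (T ∘ horProj _ _ ∘ v) - βi.1 (horProj _ _ ∘ T ∘ horProj _ _ ∘ v)) =
      βj.1 v - βj.1 (horProj _ _ ∘ v)
    change βi.1 (horProj _ _ ∘ T ∘ horProj _ _ ∘ v) = βi.1 (horProj _ _ ∘ T ∘ v) at h4
    rw [h4, h]
    change _ = βi.1 (T ∘ v) - βi.1 (T ∘ horProj _ _ ∘ v)
    ring
  change removeHor (Euc m) (Euc n) m βj = subspaceProj _
    ((removeHor (Euc m) (Euc n) m βi).1.compContinuousLinearMap T -
      ((removeHor (Euc m) (Euc n) m βi).1.compContinuousLinearMap T).compContinuousLinearMap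
        (horProj (Euc m) (Euc n)))
  rw [h3, subspaceProj_coe]

/-- Natural coordinates on `J¹π*`. -/
def dualCharts : FibreCharts (Euc m × Euc n) (DualModel m n) (DualFibre m n π) where
  base := adapted m n π
  mem_base := mem_adapted m n π
  fib i u hu := semibasicQuotientEquiv (dAdapted m n π i u hu) (dAdaptedBase m n π i u hu)
    (fst_dAdapted m n π i u hu) m
  smooth_base := contDiffOn_adaptedChange m n π
  smooth_fib i j := ⟨_, contDiffOn_proj_pullback_sub _ (horProj (Euc m) (Euc n))
    (contDiffOn_fderiv_adaptedChange' m n π i j), dual_change m n π i j⟩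

instance : TopologicalSpace (Jet m n π) := (jetCharts m n π).core.toTopologicalSpace
instance : ChartedSpace ((Euc m × Euc n) × JetModel m n) (Jet m n π) :=
  (jetCharts m n π).core.toChartedSpace
instance : IsManifold 𝓘(ℝ, (Euc m × Euc n) × JetModel m n) ∞ (Jet m n π) :=
  (jetCharts m n π).isManifold

instance : TopologicalSpace (ExtDual m n π) := (extDualCharts m n π).core.toTopologicalSpace
instance : ChartedSpace ((Euc m × Euc n) × ExtDualModel m n) (ExtDual m n π) :=
  (extDualCharts m n π).core.toChartedSpace
instance : IsManifold 𝓘(ℝ, (Euc m × Euc n) × ExtDualModel m n) ∞ (ExtDual m n π) :=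
  (extDualCharts m n π).isManifold

instance : TopologicalSpace (Dual m n π) := (dualCharts m n π).core.toTopologicalSpace
instance : ChartedSpace ((Euc m × Euc n) × DualModel m n) (Dual m n π) :=
  (dualCharts m n π).core.toChartedSpace
instance : IsManifold 𝓘(ℝ, (Euc m × Euc n) × DualModel m n) ∞ (Dual m n π) :=
  (dualCharts m n π).isManifold

end Bundles

/-! ### Forms, multivector fields and distributions on a manifold `N` modelled on `F` -/

section Manifold

variable {F : Type*} [NormedAddCommGroup F] [NormedSpace ℝ F]
  {N : Type*} [TopologicalSpace N] [ChartedSpace F N]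

variable (F N) in
/-- Differential forms of degree `k` (not necessarily smooth). -/
abbrev DiffForm (k : ℕ) : Type _ := ∀ p : N, TangentSpace 𝓘(ℝ, F) p [⋀^Fin k]→L[ℝ] ℝ

/-- The expression of a form in a chart. -/
def DiffForm.inChart {k : ℕ} (α : DiffForm F N k) (e : OpenPartialHomeomorph N F) (z : F) :
    F [⋀^Fin k]→L[ℝ] ℝ :=
  (α (e.symm z)).compContinuousLinearMap (mfderiv 𝓘(ℝ, F) 𝓘(ℝ, F) e.symm z)

/-- Smoothness of a form. -/
def DiffForm.IsSmooth {k : ℕ} (α : DiffForm F N k) : Prop :=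
  ∀ p : N, ContDiffOn ℝ ∞ (α.inChart (chartAt F p)) (chartAt F p).target

/-- The exterior derivative, computed at `p` in the preferred chart at `p`. -/
def DiffForm.d {k : ℕ} (α : DiffForm F N k) : DiffForm F N (k + 1) := fun p =>
  (extDeriv (α.inChart (chartAt F p)) (chartAt F p p)).compContinuousLinearMap
    (mfderiv 𝓘(ℝ, F) 𝓘(ℝ, F) (chartAt F p) p)

/-- The pullback of a form by a map. -/
def DiffForm.pullback {F' : Type*} [NormedAddCommGroup F'] [NormedSpace ℝ F'] {N' : Type*}
    [TopologicalSpace N'] [ChartedSpace F' N'] {k : ℕ} (f : N' → N) (α : DiffForm F N k) :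
    DiffForm F' N' k := fun p =>
  (α (f p)).compContinuousLinearMap (mfderiv 𝓘(ℝ, F') 𝓘(ℝ, F) f p)

variable (F N) in
/-- Vector fields (not necessarily smooth). -/
abbrev VField : Type _ := ∀ p : N, TangentSpace 𝓘(ℝ, F) p

variable (F N) in
/-- Multivector fields of degree `k` (not necessarily smooth). -/
abbrev MVField (k : ℕ) : Type _ := ∀ p : N, ⋀[ℝ]^k (TangentSpace 𝓘(ℝ, F) p)

variable (F N) in
/-- Families of subspaces of the tangent spaces. -/
abbrev TangentDistribution : Type _ := ∀ p : N, Submodule ℝ (TangentSpace 𝓘(ℝ, F) p)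

/-- `i(X)α = 0` for a `k`-multivector field `X` and a `(k+1)`-form `α`: at every point and for
every `w`, the linear functional `X₁ ∧ ⋯ ∧ X_k ↦ α(w, X₁, …, X_k)` vanishes at `X`. -/
def ContractionVanishes {k : ℕ} (X : MVField F N k) (α : DiffForm F N (k + 1)) : Prop :=
  ∀ (p : N) (w : TangentSpace 𝓘(ℝ, F) p),
    exteriorPower.alternatingMapLinearEquiv ((α p).toAlternatingMap.curryLeft w) (X p) = 0

/-- `D` is integrable: through every point passes a `k`-dimensional integral manifold, given by a
parametrisation `f` defined on an open set of `ℝᵏ`. -/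
def TangentDistribution.IsIntegrable (k : ℕ) (D : TangentDistribution F N) : Prop :=
  ∀ p : N, ∃ (U : Set (Euc k)) (f : Euc k → N) (y : Euc k), IsOpen U ∧ y ∈ U ∧ f y = p ∧
    ContMDiffOn (𝓡 k) 𝓘(ℝ, F) ∞ f U ∧
    ∀ z ∈ U, Injective (mfderiv (𝓡 k) 𝓘(ℝ, F) f z) ∧
      (mfderiv (𝓡 k) 𝓘(ℝ, F) f z).range = D (f z)

variable [IsManifold 𝓘(ℝ, F) ∞ N]

/-- Smoothness of a vector field on a set. -/
def VField.SmoothOn (X : VField F N) (U : Set N) : Prop :=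
  ContMDiffOn 𝓘(ℝ, F) (𝓘(ℝ, F).tangent) ∞
    (fun p => (⟨p, X p⟩ : TangentBundle 𝓘(ℝ, F) N)) U

/-- `D` is a smooth distribution of dimension `k`: a subbundle of rank `k` of the tangent bundle. -/
def TangentDistribution.HasRank (k : ℕ) (D : TangentDistribution F N) : Prop :=
  ∀ p : N, ∃ (U : Set N) (X : Fin k → VField F N), IsOpen U ∧ p ∈ U ∧ (∀ i, (X i).SmoothOn U) ∧
    ∀ q ∈ U, LinearIndependent ℝ (fun i => X i q) ∧ D q = Submodule.span ℝ (range fun i => X i q)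

/-- `X` is locally decomposable: locally the exterior product of smooth vector fields. -/
def MVField.IsLocallyDecomposable {k : ℕ} (X : MVField F N k) : Prop :=
  ∀ p : N, ∃ (U : Set N) (Y : Fin k → VField F N), IsOpen U ∧ p ∈ U ∧ (∀ i, (Y i).SmoothOn U) ∧
    ∀ q ∈ U, X q = exteriorPower.ιMulti ℝ k (fun i => Y i q)

/-- `X` belongs to the class of multivector fields associated with the distribution `D`: it is a
non-vanishing, locally decomposable `k`-multivector field and a section of `Λᵏ D`. -/
structure MVField.IsAssociated {k : ℕ} (X : MVField F N k) (D : TangentDistribution F N) : Prop where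
  ne_zero : ∀ p, X p ≠ 0
  locallyDecomposable : X.IsLocallyDecomposable
  mem : ∀ p, X p ∈ LinearMap.range (exteriorPower.map k (D p).subtype)

end Manifold

/-! ### Local sections and integral sections -/

section Sections

variable {m : ℕ} {M : Type*} [TopologicalSpace M] [ChartedSpace (Euc m) M]
  {F : Type*} [NormedAddCommGroup F] [NormedSpace ℝ F]
  {N : Type*} [TopologicalSpace N] [ChartedSpace F N]

/-- `ψ` is a local section of `ρ : N → M` defined on the open set `U`. -/
structure IsLocalSection (ρ : N → M) (U : Set M) (ψ : M → N) : Prop where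
  isOpen : IsOpen U
  smooth : ContMDiffOn (𝓡 m) 𝓘(ℝ, F) ∞ ψ U
  proj : ∀ x ∈ U, ρ (ψ x) = x

/-- The image of `ψ : U → N` is an integral manifold of `D`. -/
def TangentDistribution.IsIntegralSection (D : TangentDistribution F N) (U : Set M) (ψ : M → N) : Prop :=
  ∀ x ∈ U, (mfderiv (𝓡 m) 𝓘(ℝ, F) ψ x).range = D (ψ x)

/-- `D` is transverse to `ρ : N → M`: no non-zero vector of `D` is `ρ`-vertical. -/
def TangentDistribution.IsTransverse (D : TangentDistribution F N) (ρ : N → M) : Prop :=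
  ∀ p, Disjoint (D p) (mfderiv 𝓘(ℝ, F) (𝓡 m) ρ p).ker

/-- `η` is a volume form on `M`. -/
structure IsVolumeForm (η : DiffForm (Euc m) M m) : Prop where
  smooth : η.IsSmooth
  ne_zero : ∀ x, η x ≠ 0

end Sections

/-! ### Projections -/

section Projections

variable {m n : ℕ} {M E : Type*} [TopologicalSpace M] [ChartedSpace (Euc m) M]
  [TopologicalSpace E] [ChartedSpace (Euc (m + n)) E] {π : E → M}

/-- The projection `π¹ : J¹π → E`. -/
def Jet.toE (j : Jet m n π) : E := Bundle.TotalSpace.proj j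

/-- The projection `π̄¹ : J¹π → M`. -/
def Jet.toM (j : Jet m n π) : M := π j.toE

/-- The differential `T_x φ` that represents the jet `j`. -/
def Jet.hom (j : Jet m n π) : TangentSpace (𝓡 m) (π j.toE) →L[ℝ] TangentSpace (𝓡 (m + n)) j.toE :=
  (Bundle.TotalSpace.snd j).1

/-- The jet over `u` given by an element of the fibre. -/
def Jet.mk (u : E) (A : JetFibre m n π u) : Jet m n π := ⟨u, A⟩

/-- The projection `π_E : Λ₂ᵐ(T*E) → E`. -/
def ExtDual.toE (b : ExtDual m n π) : E := Bundle.TotalSpace.proj b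

/-- The form `β` that constitutes the point `(u, β)` of `Λ₂ᵐ(T*E)`. -/
def ExtDual.form (b : ExtDual m n π) : TangentSpace (𝓡 (m + n)) b.toE [⋀^Fin m]→L[ℝ] ℝ :=
  (Bundle.TotalSpace.snd b).1

/-- The projection `π_Eʳ : J¹π* → E`. -/
def Dual.toE (b : Dual m n π) : E := Bundle.TotalSpace.proj b

/-- The projection `π̄_Eʳ : J¹π* → M`. -/
def Dual.toM (b : Dual m n π) : M := π b.toE

/-- The point of `J¹π*` over `u` given by an element of the fibre. -/
def Dual.mk (u : E) (q : DualFibre m n π u) : Dual m n π := ⟨u, q⟩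

/-- The quotient map `Λ₂ᵐ(T*E) → J¹π*`. -/
def ExtDual.toDual (b : ExtDual m n π) : Dual m n π :=
  ⟨Bundle.TotalSpace.proj b, SemibasicQuotient.mk (Bundle.TotalSpace.snd b)⟩

end Projections

/-! ### The Cartan forms of a Lagrangian and of a Hamiltonian section -/

section Cartan

/-- For a `k`-form `η` and linear maps `V`, `W`, the `k`-form
`(Y₁, …, Y_k) ↦ ∑ l, η(V Y₁, …, W Y_l, …, V Y_k)`. -/
def insertionSum {X Y : Type*} [AddCommGroup X] [Module ℝ X] [TopologicalSpace X]
    [AddCommGroup Y] [Module ℝ Y] [TopologicalSpace Y] {k : ℕ}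
    (η : Y [⋀^Fin k]→L[ℝ] ℝ) (V W : X →L[ℝ] Y) : X [⋀^Fin k]→L[ℝ] ℝ where
  toContinuousMultilinearMap := ∑ l : Fin k,
    η.toContinuousMultilinearMap.compContinuousLinearMap (fun i => if i = l then W else V)
  map_eq_zero_of_eq' := by
    intro v i j hv hij
    change (∑ l : Fin k, η.toContinuousMultilinearMap.compContinuousLinearMap
      (fun i => if i = l then W else V)) v = 0
    rw [sum_apply,
      ← Finset.sum_subset (Finset.subset_univ {i, j})]
    · rw [Finset.sum_pair hij]
      have h := η.toAlternatingMap.map_swap (fun a => (if a = i then W else V) (v a)) hij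
      have h' : ((fun a => (if a = i then W else V) (v a)) ∘ Equiv.swap i j) =
          fun a => (if a = j then W else V) (v a) := by
        funext a
        by_cases hai : a = i
        · subst hai
          simp [hij, hij.symm, hv]
        · by_cases haj : a = j
          · subst haj
            simp [hv]
          · simp [Equiv.swap_apply_of_ne_of_ne hai haj, hai, haj]
      rw [h'] at h
      change η.toAlternatingMap (fun a => (if a = i then W else V) (v a)) +
        η.toAlternatingMap (fun a => (if a = j then W else V) (v a)) = 0
      rw [h, add_neg_cancel]
    · intro l _ hl
      simp only [Finset.mem_insert, Finset.mem_singleton, not_or] at hl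
      refine η.map_eq_zero_of_eq _ (i := i) (j := j) ?_ hij
      simp [Ne.symm hl.1, Ne.symm hl.2, hv]

variable {m n : ℕ} {M E : Type*} [TopologicalSpace M] [ChartedSpace (Euc m) M]
  [TopologicalSpace E] [ChartedSpace (Euc (m + n)) E] {π : E → M}

variable (m n π) in
/-- `T_u π`, where tangent spaces are written as the model spaces. -/
def dproj (u : E) : Euc (m + n) →L[ℝ] Euc m := mfderiv (𝓡 (m + n)) (𝓡 m) π u

variable (m n π) in
/-- The space `V_u π` of vertical tangent vectors at `u`. -/
def vert (u : E) : Submodule ℝ (Euc (m + n)) := (dproj m n π u).ker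

/-- `Jet.hom`, where tangent spaces are written as the model spaces. -/
def Jet.lift (j : Jet m n π) : Euc m →L[ℝ] Euc (m + n) := j.hom

theorem Jet.dproj_lift (j : Jet m n π) (v : Euc m) : dproj m n π j.toE (j.lift v) = v :=
  DFunLike.congr_fun (Bundle.TotalSpace.snd j).2 v

/-- The affine structure of the fibres of `π¹`: translation of a jet by a linear map
`B : T_x M → V_u π`. -/
def Jet.translate (j : Jet m n π) (B : Euc m →L[ℝ] vert m n π j.toE) : Jet m n π :=
  Jet.mk j.toE ⟨(j.lift + (vert m n π j.toE).subtypeL.comp B : Euc m →L[ℝ] Euc (m + n)), by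
    ext1 v
    change dproj m n π j.toE (j.lift v + (B v : Euc (m + n))) = v
    have h2 : dproj m n π j.toE (B v : Euc (m + n)) = 0 := (B v).2
    rw [map_add, h2, add_zero]
    exact j.dproj_lift v⟩

/-- The derivative at `j` of a function `L` on `J¹π` along the fibre of `π¹`. It is `dL` composed
with the vertical lift of linear maps `B : T_x M → V_u π` to vertical vectors at `j`. -/
def fibreDeriv (L : Jet m n π → ℝ) (j : Jet m n π) :
    (Euc m →L[ℝ] vert m n π j.toE) →L[ℝ] ℝ :=
  fderiv ℝ (fun B => L (j.translate B)) 0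

variable (m n) in
/-- Model vector space of `J¹π`. -/
abbrev JetSpace : Type := (Euc m × Euc n) × JetModel m n

variable (m n) in
/-- Model vector space of `Λ₂ᵐ(T*E)`. -/
abbrev ExtDualSpace : Type := (Euc m × Euc n) × ExtDualModel m n

variable (m n) in
/-- Model vector space of `J¹π*`. -/
abbrev DualSpace : Type := (Euc m × Euc n) × DualModel m n

variable [hπ : IsFibredManifold m n π]

/-- `T_j π¹`, where tangent spaces are written as the model spaces. -/
def dJet (j : Jet m n π) : JetSpace m n →L[ℝ] Euc (m + n) :=
  mfderiv 𝓘(ℝ, JetSpace m n) (𝓡 (m + n)) Jet.toE j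

/-- `T_j π̄¹ = T_u π ∘ T_j π¹`. -/
def dJetBase (j : Jet m n π) : JetSpace m n →L[ℝ] Euc m := (dproj m n π j.toE).comp (dJet j)

/-- The canonical structure form `θ_j(Y) = Tπ¹(Y) - T(φ ∘ π)(Tπ¹(Y))`, where `j` is the jet
of `φ`; it takes values in the vertical vectors. -/
def structureForm (j : Jet m n π) : JetSpace m n →L[ℝ] vert m n π j.toE :=
  (dJet j - j.lift.comp (dJetBase j)).codRestrict (vert m n π j.toE) fun Y => by
    change dproj m n π j.toE (dJet j Y - j.lift (dproj m n π j.toE (dJet j Y))) = 0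
    rw [map_sub, j.dproj_lift, sub_self]

/-- The contraction of `dL` with the canonical vertical endomorphism, as the linear map
`Y ↦ ∑ i, dL(vertical lift of dxⁱ ⊗ θ(Y)) ∂/∂xⁱ` from `T_j J¹π` to `T_x M`. -/
def momentum (L : Jet m n π → ℝ) (j : Jet m n π) : JetSpace m n →L[ℝ] Euc m :=
  ∑ i : Fin m, ((fibreDeriv L j).comp ((ContinuousLinearMap.smulRightL ℝ (Euc m) (vert m n π j.toE)
    (EuclideanSpace.proj i)).comp (structureForm j))).smulRight (EuclideanSpace.single i (1 : ℝ))

/-- The Cartan `m`-form `Θ_L = i(ν)d𝓛 + 𝓛` of the Lagrangian density `𝓛 = L η`; in natural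
coordinates with `η = dᵐx` it is
`∂L/∂u_i^α (du^α - u_j^α dxʲ) ∧ dᵐ⁻¹x_i + L dᵐx`. -/
def cartanForm (η : DiffForm (Euc m) M m) (L : Jet m n π → ℝ) :
    DiffForm (JetSpace m n) (Jet m n π) m := fun j =>
  (insertionSum (η (π j.toE) : Euc m [⋀^Fin m]→L[ℝ] ℝ) (dJetBase j) (momentum L j) +
    L j • (η (π j.toE) : Euc m [⋀^Fin m]→L[ℝ] ℝ).compContinuousLinearMap (dJetBase j) :
    JetSpace m n [⋀^Fin m]→L[ℝ] ℝ)

/-- The Cartan `(m+1)`-form `Ω_L = -dΘ_L`. -/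
def cartanMultisymplecticForm (η : DiffForm (Euc m) M m) (L : Jet m n π → ℝ) :
    DiffForm (JetSpace m n) (Jet m n π) (m + 1) := fun j => -(cartanForm η L).d j

variable (m n π) in
/-- The Liouville `m`-form `Θ` on `Λ₂ᵐ(T*E)`. -/
def liouvilleForm : DiffForm (ExtDualSpace m n) (ExtDual m n π) m := fun b =>
  b.form.compContinuousLinearMap
    (mfderiv 𝓘(ℝ, ExtDualSpace m n) (𝓡 (m + n)) ExtDual.toE b)

variable (m n π) in
/-- The Liouville `(m+1)`-form `Ω = -dΘ` on `Λ₂ᵐ(T*E)`. -/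
def liouvilleMultisymplecticForm : DiffForm (ExtDualSpace m n) (ExtDual m n π) (m + 1) := fun b =>
  -(liouvilleForm m n π).d b

/-- `h` is a Hamiltonian section: a smooth section of `Λ₂ᵐ(T*E) → J¹π*`. -/
structure IsHamiltonianSection (h : Dual m n π → ExtDual m n π) : Prop where
  smooth : ContMDiff 𝓘(ℝ, DualSpace m n) 𝓘(ℝ, ExtDualSpace m n) ∞ h
  toDual : ∀ b, (h b).toDual = b

/-- The Hamilton-Cartan `(m+1)`-form `Ω_h = h^*Ω`. -/
def hamiltonCartanMultisymplecticForm (h : Dual m n π → ExtDual m n π) :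
    DiffForm (DualSpace m n) (Dual m n π) (m + 1) := (liouvilleMultisymplecticForm m n π).pullback h

end Cartan

/-! ### The field equations and the generalized Hamilton-Jacobi problem -/

section Problem

variable {m n : ℕ} {M E : Type*} [TopologicalSpace M] [ChartedSpace (Euc m) M]
  [TopologicalSpace E] [ChartedSpace (Euc (m + n)) E] {π : E → M}

/-- The field equation `ψ^* i(X)Ω = 0` on `U` for all vector fields `X`. -/
def SolvesFieldEquation {F N : Type*} [NormedAddCommGroup F] [NormedSpace ℝ F]
    [TopologicalSpace N] [ChartedSpace F N] [IsManifold 𝓘(ℝ, F) ∞ N]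
    (Ω : DiffForm F N (m + 1)) (U : Set M) (ψ : M → N) : Prop :=
  ∀ X : VField F N, X.SmoothOn univ → ∀ x ∈ U, ∀ v : Fin m → TangentSpace (𝓡 m) x,
    Ω (ψ x) (Fin.cons (X (ψ x)) fun i => mfderiv (𝓡 m) 𝓘(ℝ, F) ψ x (v i)) = 0

/-- `ψ = j¹φ` on `U`. -/
def IsProlongation (U : Set M) (φ : M → E) (ψ : M → Jet m n π) : Prop :=
  ∀ x ∈ U, (ψ x).toE = φ x ∧
    (ψ x).lift = (mfderiv (𝓡 m) (𝓡 (m + n)) φ x : Euc m →L[ℝ] Euc (m + n))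

variable [hπ : IsFibredManifold m n π]

/-- `D` is a solution of the Lagrangian problem: an `m`-dimensional, `π̄¹`-transverse and integrable
distribution in `J¹π` whose integral sections are prolongations of sections of `π` satisfying the
field equation. -/
structure IsLagrangianSolution (η : DiffForm (Euc m) M m) (L : Jet m n π → ℝ)
    (D : TangentDistribution (JetSpace m n) (Jet m n π)) : Prop where
  hasRank : D.HasRank m
  transverse : D.IsTransverse (m := m) (Jet.toM : Jet m n π → M)
  integrable : D.IsIntegrable m
  sections : ∀ (U : Set M) (ψ : M → Jet m n π),
    IsLocalSection (m := m) (F := JetSpace m n) Jet.toM U ψ → D.IsIntegralSection (m := m) U ψ →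
    ∃ φ : M → E, IsLocalSection (m := m) (F := Euc (m + n)) π U φ ∧ IsProlongation U φ ψ ∧
      SolvesFieldEquation (m := m) (cartanMultisymplecticForm η L) U ψ

/-- `D` is a solution of the Hamiltonian problem: an `m`-dimensional, `π̄_Eʳ`-transverse and
integrable distribution in `J¹π*` whose integral sections satisfy the field equation. -/
structure IsHamiltonianSolution (h : Dual m n π → ExtDual m n π)
    (D : TangentDistribution (DualSpace m n) (Dual m n π)) : Prop where
  hasRank : D.HasRank m
  transverse : D.IsTransverse (m := m) (Dual.toM : Dual m n π → M)
  integrable : D.IsIntegrable m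
  sections : ∀ (U : Set M) (ψ : M → Dual m n π),
    IsLocalSection (m := m) (F := DualSpace m n) Dual.toM U ψ → D.IsIntegralSection (m := m) U ψ →
    SolvesFieldEquation (m := m) (hamiltonCartanMultisymplecticForm h) U ψ

/-- The generalized Hamilton-Jacobi condition for a map `Φ : E → P` into a phase space: if a local
section `γ` of `π` is an integral section of `D`, then `Φ ∘ γ` is one of `DP`. -/
def GenHJCondition {F P : Type*} [NormedAddCommGroup F] [NormedSpace ℝ F]
    [TopologicalSpace P] [ChartedSpace F P] (π : E → M) (D : TangentDistribution (Euc (m + n)) E)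
    (DP : TangentDistribution F P) (Φ : E → P) : Prop :=
  ∀ (U : Set M) (γ : M → E), IsLocalSection (m := m) (F := Euc (m + n)) π U γ → D.IsIntegralSection (m := m) U γ →
    DP.IsIntegralSection (m := m) U (Φ ∘ γ)

end Problem

end FieldHJ

end

open FieldHJ

noncomputable section

open Set Function
open scoped Topology

namespace FieldHJ

/-! Both halves are instances of one statement, `GenHJCondition.exists_multivectorField`, about a
phase space `r : P → E` carrying an integrable rank-`m` distribution `DP` transverse to `π ∘ r`, and
a section `σ` of `r` that carries integral sections of `D` to integral sections of `DP`. The form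
`Ω` enters only through the field equation satisfied by the integral sections of `DP`.

Since `DP` is integrable and transverse, the inverse function theorem turns an integral manifold
through `p` into a local integral section `ψ` through `p`
(`TangentDistribution.IsIntegrable.exists_isIntegralSection`). Its differential is the horizontal
lift `S p`, the inverse of the isomorphism from `DP p` to the tangent space of `M` induced by `T(π ∘
r)`. Given `X` associated with `D`, project `X (r p)` to `M` and lift it: `XP p = Λᵐ(S p ∘ Tπ) (X (r
p))`. This is defined on all of `P`, not only on the image of `σ`.

It does not vanish, because `Tπ` is injective on `D` and `S p` is injective. It lies in `Λᵐ DP`,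
because `S p` takes values in `DP p`. It is locally decomposable, because the lifts of smooth
factors of `X` have smooth coefficients in a local frame of `DP`. Its contraction with `Ω` is zero,
because `S p` is `Tψ` for a solution `ψ` of the field equation and every tangent vector extends to a
global smooth vector field.

Finally, `T(σ ∘ γ) = Tσ ∘ Tγ` along integral sections `γ` of `D` shows that `Tσ` maps `D u` onto `DP
(σ u)`. For `v` in `D u` the vector `Tσ v` therefore lies in `DP` and projects to `Tπ v`, so it is
the horizontal lift of `Tπ v`, and `Tr` sends it back to `v`. Thus `Tr ∘ S ∘ Tπ` is the identity on
`D u`, which gives both the formula for `X` and the formula for `D`. -/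

theorem exists_continuousLinearEquiv_of_injective {V : Type*} [NormedAddCommGroup V]
    [NormedSpace ℝ V] [FiniteDimensional ℝ V] (L : V →L[ℝ] V) (hL : Injective L) :
    ∃ A : V ≃L[ℝ] V, (A : V →L[ℝ] V) = L :=
  ⟨(LinearEquiv.ofInjectiveEndo (L : V →ₗ[ℝ] V) hL).toContinuousLinearEquiv, rfl⟩

/-! ### Integral sections of transverse distributions; extension and differentiation along vector
fields -/

section IntegralSections

variable {m : ℕ} {M : Type*} [TopologicalSpace M] [ChartedSpace (Euc m) M]
  {F : Type*} [NormedAddCommGroup F] [NormedSpace ℝ F]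
  {N : Type*} [TopologicalSpace N] [ChartedSpace F N]

/-- Differentiate `ρ ∘ ψ = id`, which holds near `x` because `U` is open. -/
theorem IsLocalSection.mfderiv_comp {ρ : N → M} (hρ : MDifferentiable 𝓘(ℝ, F) (𝓡 m) ρ)
    {U : Set M} {ψ : M → N} (hψ : IsLocalSection (m := m) (F := F) ρ U ψ) {x : M} (hx : x ∈ U)
    (v : TangentSpace (𝓡 m) x) :
    mfderiv 𝓘(ℝ, F) (𝓡 m) ρ (ψ x) (mfderiv (𝓡 m) 𝓘(ℝ, F) ψ x v) = v := by
  have hψx : MDifferentiableAt (𝓡 m) 𝓘(ℝ, F) ψ x :=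
    (hψ.smooth.contMDiffAt (hψ.isOpen.mem_nhds hx)).mdifferentiableAt (by simp)
  have h1 := (hρ (ψ x)).hasMFDerivAt.comp x hψx.hasMFDerivAt
  have h2 : ρ ∘ ψ =ᶠ[𝓝 x] id :=
    Filter.eventuallyEq_of_mem (hψ.isOpen.mem_nhds hx) hψ.proj
  exact DFunLike.congr_fun
    (hasMFDerivAt_unique h1 ((hasMFDerivAt_id x).congr_of_eventuallyEq h2)) v

/-- Transversality makes `Tρ` injective on `D`, while `Tρ` already maps the range of `Tψ` onto the
whole tangent space of `M`. So `D` cannot be larger than that range, and one inclusion suffices. -/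
theorem TangentDistribution.IsTransverse.isIntegralSection {ρ : N → M}
    (hρ : MDifferentiable 𝓘(ℝ, F) (𝓡 m) ρ) {D : TangentDistribution F N}
    (hD : D.IsTransverse (m := m) ρ) {U : Set M} {ψ : M → N}
    (hψ : IsLocalSection (m := m) (F := F) ρ U ψ)
    (h : ∀ x ∈ U, (mfderiv (𝓡 m) 𝓘(ℝ, F) ψ x).range ≤ D (ψ x)) :
    D.IsIntegralSection (m := m) U ψ := by
  intro x hx
  refine le_antisymm (h x hx) fun w hw => ?_
  -- `v` is `Tρ w`, read as a vector at `x` instead of `ρ (ψ x)`; both tangent spaces are the same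
  -- model space.
  obtain ⟨v, hv⟩ : ∃ v : TangentSpace (𝓡 m) x, mfderiv 𝓘(ℝ, F) (𝓡 m) ρ (ψ x) w = v := ⟨_, rfl⟩
  have h1 : w - mfderiv (𝓡 m) 𝓘(ℝ, F) ψ x v ∈ D (ψ x) := sub_mem hw (h x hx ⟨v, rfl⟩)
  have h2 : mfderiv 𝓘(ℝ, F) (𝓡 m) ρ (ψ x) (w - mfderiv (𝓡 m) 𝓘(ℝ, F) ψ x v) = 0 := by
    rw [map_sub, hv]
    exact sub_eq_zero.2 (hψ.mfderiv_comp hρ hx v).symm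
  exact ⟨v, (sub_eq_zero.1 (Submodule.disjoint_def.1 (hD (ψ x)) _ h1 h2)).symm⟩

/-- Through every point of a manifold over `M` passes a local integral section of an integrable
transverse distribution. -/
theorem TangentDistribution.IsIntegrable.exists_isIntegralSection [IsManifold (𝓡 m) ∞ M]
    {ρ : N → M} (hρ : ContMDiff 𝓘(ℝ, F) (𝓡 m) ∞ ρ) {D : TangentDistribution F N}
    (hD : D.IsIntegrable m) (ht : D.IsTransverse (m := m) ρ) (p : N) :
    ∃ (U : Set M) (ψ : M → N), IsLocalSection (m := m) (F := F) ρ U ψ ∧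
      D.IsIntegralSection (m := m) U ψ ∧ ρ p ∈ U ∧ ψ (ρ p) = p := by
  obtain ⟨U, f, y, hU, hy, rfl, hf, hfD⟩ := hD p
  have hρ' : MDifferentiable 𝓘(ℝ, F) (𝓡 m) ρ := hρ.mdifferentiable (by simp)
  set c := chartAt (Euc m) (ρ (f y))
  set W := U ∩ (ρ ∘ f) ⁻¹' c.source
  have hρf : ContMDiffOn (𝓡 m) (𝓡 m) ∞ (ρ ∘ f) U := hρ.comp_contMDiffOn hf
  have hW : IsOpen W := hρf.continuousOn.isOpen_inter_preimage hU c.open_source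
  have hyW : y ∈ W := ⟨hy, mem_chart_source _ _⟩
  have hg : ContDiffOn ℝ ∞ (c ∘ ρ ∘ f) W := by
    rw [← contMDiffOn_iff_contDiffOn]
    exact contMDiffOn_chart.comp (hρf.mono inter_subset_left) fun z hz => hz.2
  have hg' : ∀ z ∈ W, ContDiffAt ℝ ∞ (c ∘ ρ ∘ f) z := fun z hz => hg.contDiffAt (hW.mem_nhds hz)
  have hfz : ∀ z ∈ U, MDifferentiableAt (𝓡 m) 𝓘(ℝ, F) f z := fun z hz =>
    (hf.contMDiffAt (hU.mem_nhds hz)).mdifferentiableAt (by simp)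
  -- `f` is an immersion with directions in `D`, `Tρ` is injective on `D`, and the chart is a
  -- diffeomorphism. The composite derivative is thus an injective endomorphism of `Euc m`, hence
  -- invertible, at every point of `W`.
  have hA : ∀ z ∈ W, ∃ A : Euc m ≃L[ℝ] Euc m,
      HasFDerivAt (c ∘ ρ ∘ f) (A : Euc m →L[ℝ] Euc m) z := by
    intro z hz
    have h1 := ((mdifferentiable_chart (I := 𝓡 m) (ρ (f y))).mdifferentiableAt
      hz.2).hasMFDerivAt.comp z ((hρ' (f z)).hasMFDerivAt.comp z (hfz z hz.1).hasMFDerivAt)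
    have hinj : Injective (fderiv ℝ (c ∘ ρ ∘ f) z) := by
      rw [← mfderiv_eq_fderiv, h1.mfderiv]
      refine (((mdifferentiable_chart (I := 𝓡 m) (ρ (f y))).mfderiv hz.2).injective).comp ?_
      intro v w hvw
      have hmem : ∀ v, mfderiv (𝓡 m) 𝓘(ℝ, F) f z v ∈ D (f z) := fun v =>
        (hfD z hz.1).2.le ⟨v, rfl⟩
      refine (hfD z hz.1).1 (sub_eq_zero.1
        (Submodule.disjoint_def.1 (ht (f z)) _ (sub_mem (hmem v) (hmem w)) ?_))
      exact (map_sub (mfderiv 𝓘(ℝ, F) (𝓡 m) ρ (f z)) _ _).trans (sub_eq_zero.2 hvw)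
    obtain ⟨A, hA⟩ := exists_continuousLinearEquiv_of_injective _ hinj
    exact ⟨A, hA ▸ ((hg' z hz).differentiableAt (by simp)).hasFDerivAt⟩
  obtain ⟨A, hAy⟩ := hA y hyW
  -- Restriction to `W` keeps the derivative invertible on the whole source, so that `e.symm` is
  -- smooth on its whole target and not just near the image of `y`.
  set e := ((hg' y hyW).toOpenPartialHomeomorph _ hAy (by simp)).restrOpen W hW
  have hye : y ∈ e.source :=
    ⟨(hg' y hyW).mem_toOpenPartialHomeomorph_source hAy (by simp), hyW⟩
  have heW : ∀ x ∈ e.target, e.symm x ∈ W := fun x hx => (e.map_target hx).2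
  have hesymm : ContDiffOn ℝ ∞ e.symm e.target := fun x hx => by
    obtain ⟨B, hB⟩ := hA _ (heW x hx)
    exact (e.contDiffAt_symm hx hB (hg' _ (heW x hx))).contDiffWithinAt
  have hUc : IsOpen (c.source ∩ c ⁻¹' e.target) := c.isOpen_inter_preimage e.open_target
  -- Reparametrising `f` by the inverse of `c ∘ ρ ∘ f` gives a section: `c` is injective on its
  -- source, and `c ∘ ρ` of the new map is `c`.
  have hsec : IsLocalSection (m := m) (F := F) ρ (c.source ∩ c ⁻¹' e.target)
      (f ∘ e.symm ∘ c) := by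
    refine ⟨hUc, ?_, fun x hx => ?_⟩
    · exact hf.comp (hesymm.contMDiffOn.comp (contMDiffOn_chart.mono inter_subset_left)
        fun x hx => hx.2) fun x hx => (heW _ hx.2).1
    · refine c.injOn (heW _ hx.2).2 hx.1 ?_
      exact e.right_inv hx.2
  -- Only the inclusion of the range in `D` is left, and by the chain rule the differential factors
  -- through that of `f`.
  refine ⟨_, _, hsec, ht.isIntegralSection hρ' hsec fun x hx => ?_,
    ⟨mem_chart_source _ _, e.map_source hye⟩, ?_⟩
  · have h1 : MDifferentiableAt (𝓡 m) (𝓡 m) (e.symm ∘ c) x :=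
      ((hesymm.contMDiffOn.comp (contMDiffOn_chart.mono inter_subset_left)
        fun x hx => hx.2).contMDiffAt (hUc.mem_nhds hx)).mdifferentiableAt (by simp)
    have hz := heW _ hx.2
    rw [((hfz _ hz.1).hasMFDerivAt.comp x h1.hasMFDerivAt).mfderiv]
    rintro _ ⟨v, rfl⟩
    exact (hfD _ hz.1).2.le ⟨_, rfl⟩
  · exact congrArg f (e.left_inv hye)

/-- Every tangent vector of a Hausdorff manifold is the value of a smooth vector field. -/
theorem VField.exists_smooth_apply_eq [FiniteDimensional ℝ F] [IsManifold 𝓘(ℝ, F) ∞ N] [T2Space N]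
    (p : N) (w : TangentSpace 𝓘(ℝ, F) p) :
    ∃ X : VField F N, X.SmoothOn univ ∧ X p = w := by
  obtain ⟨s, hs, hX⟩ := FiberBundle.exists_contMDiffOn_extend (k := ∞) 𝓘(ℝ, F) F w
  obtain ⟨U, hUs, hU, hp⟩ := mem_nhds_iff.1 hs
  -- Testing the neighbourhood basis on `univ` just produces some bump function with closed support
  -- in `U`. It equals 1 at `p`, so cutting off the local extension of `w` keeps its value there.
  obtain ⟨b, hb, -⟩ := (SmoothBumpFunction.nhds_basis_support (I := 𝓘(ℝ, F))
    (hU.mem_nhds hp)).mem_iff.1 Filter.univ_mem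
  refine ⟨(b : N → ℝ) • FiberBundle.extend F w, ?_, ?_⟩
  · exact (ContMDiffOn.smul_section_of_tsupport b.contMDiff.contMDiffOn hU hb
      (hX.mono hUs)).contMDiffOn
  · simp

/-- The tangent map of `A` composed with `X` is smooth into the tangent bundle of `G`, and that
bundle is trivial, so its fibre component is smooth. On the open set `U` the derivative within `U`
is the ordinary one. -/
theorem VField.SmoothOn.mfderiv_apply [IsManifold 𝓘(ℝ, F) ∞ N] {G : Type*} [NormedAddCommGroup G]
    [NormedSpace ℝ G] {X : VField F N} {U : Set N} (hX : X.SmoothOn U) (hU : IsOpen U)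
    {A : N → G} (hA : ContMDiffOn 𝓘(ℝ, F) 𝓘(ℝ, G) ∞ A U) :
    ContMDiffOn 𝓘(ℝ, F) 𝓘(ℝ, G) ∞ (fun p => (mfderiv 𝓘(ℝ, F) 𝓘(ℝ, G) A p (X p) : G)) U := by
  have : IsManifold 𝓘(ℝ, F) 1 N := IsManifold.of_le (n := ∞) (by simp)
  have h1 := (hA.contMDiffOn_tangentMapWithin (m := ∞) (by simp) hU.uniqueMDiffOn).comp hX
    fun p hp => hp
  refine ((contMDiff_snd_tangentBundle_modelSpace G 𝓘(ℝ, G)).comp_contMDiffOn h1).congr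
    fun p hp => ?_
  change _ = mfderivWithin 𝓘(ℝ, F) 𝓘(ℝ, G) A U p (X p)
  rw [mfderivWithin_of_isOpen hU hp]

end IntegralSections

/-! ### Linear algebra of multivectors -/

section Multivectors

variable {V W : Type*} [AddCommGroup V] [Module ℝ V] [AddCommGroup W] [Module ℝ W]
  {k : ℕ} {D : Submodule ℝ V} {z : ⋀[ℝ]^k V}

/-- `z` comes from the exterior power of `D`, on which `A` is injective, and over a field exterior
powers preserve injectivity. -/
theorem exteriorPower_map_ne_zero (hz : z ∈ LinearMap.range (exteriorPower.map k D.subtype))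
    (hz0 : z ≠ 0) (A : V →ₗ[ℝ] W) (hA : Disjoint D (LinearMap.ker A)) :
    exteriorPower.map k A z ≠ 0 := by
  obtain ⟨y, rfl⟩ := hz
  have hinj : Injective (A ∘ₗ D.subtype) := by
    rw [← LinearMap.ker_eq_bot, LinearMap.ker_eq_bot']
    intro v hv
    exact Subtype.ext (Submodule.disjoint_def.1 hA v v.2 hv)
  rw [← LinearMap.comp_apply, ← exteriorPower.map_comp]
  intro h
  rw [exteriorPower.map_injective_field hinj (h.trans (map_zero _).symm), map_zero] at hz0
  exact hz0 rfl

theorem exteriorPower_map_eq_self (hz : z ∈ LinearMap.range (exteriorPower.map k D.subtype))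
    (A : V →ₗ[ℝ] V) (hA : ∀ v ∈ D, A v = v) : exteriorPower.map k A z = z := by
  obtain ⟨y, rfl⟩ := hz
  have h : A ∘ₗ D.subtype = D.subtype := LinearMap.ext fun v => hA v v.2
  rw [← LinearMap.comp_apply, ← exteriorPower.map_comp, h]

/-- By functoriality: `A` factors through the inclusion of `D`. -/
theorem exteriorPower_map_mem_range (A : W →ₗ[ℝ] V) (hA : ∀ w, A w ∈ D) (y : ⋀[ℝ]^k W) :
    exteriorPower.map k A y ∈ LinearMap.range (exteriorPower.map k D.subtype) := by
  refine ⟨exteriorPower.map k (A.codRestrict D hA) y, ?_⟩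
  rw [← LinearMap.comp_apply, ← exteriorPower.map_comp, LinearMap.subtype_comp_codRestrict]

/-- Decomposable multivectors span, so a functional that vanishes on the images of decomposables
vanishes on the image. This turns the field equation, stated for `m`-tuples of vectors, into the
vanishing of a contraction. -/
theorem alternatingMapLinearEquiv_map_eq_zero (α : V [⋀^Fin k]→ₗ[ℝ] ℝ) (A : W →ₗ[ℝ] V)
    (h : ∀ w : Fin k → W, α (A ∘ w) = 0) (y : ⋀[ℝ]^k W) :
    exteriorPower.alternatingMapLinearEquiv α (exteriorPower.map k A y) = 0 := by
  have h1 : exteriorPower.alternatingMapLinearEquiv α ∘ₗ exteriorPower.map k A = 0 := by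
    ext w
    simpa [exteriorPower.map_apply_ιMulti,
      exteriorPower.alternatingMapLinearEquiv_apply_ιMulti] using h w
  exact DFunLike.congr_fun h1 y

end Multivectors

/-! ### Coefficients with respect to a smooth frame -/

/-- The coordinates of a smooth vector-valued map with respect to a smooth frame are smooth. -/
theorem exists_smooth_coefficients {F : Type*} [NormedAddCommGroup F] [NormedSpace ℝ F]
    {N : Type*} [TopologicalSpace N] [ChartedSpace F N] {m : ℕ} {U : Set N}
    {b : Fin m → N → Euc m} {a : N → Euc m}
    (hb : ∀ j, ContMDiffOn 𝓘(ℝ, F) 𝓘(ℝ, Euc m) ∞ (b j) U)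
    (hli : ∀ p ∈ U, LinearIndependent ℝ fun j => b j p)
    (ha : ContMDiffOn 𝓘(ℝ, F) 𝓘(ℝ, Euc m) ∞ a U) :
    ∃ c : Fin m → N → ℝ, (∀ j, ContMDiffOn 𝓘(ℝ, F) 𝓘(ℝ, ℝ) ∞ (c j) U) ∧
      ∀ p ∈ U, ∑ j, c j p • b j p = a p := by
  -- `L v` is the matrix with columns `v j`; it is continuous linear in `v`, so `L (b · p)` depends
  -- smoothly on `p`.
  let L : (Fin m → Euc m) →L[ℝ] (Euc m →L[ℝ] Euc m) :=
    ∑ j, (ContinuousLinearMap.smulRightL ℝ (Euc m) (Euc m) (EuclideanSpace.proj j)).comp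
      (ContinuousLinearMap.proj j)
  have hL : ∀ v x, L v x = ∑ j, x j • v j := fun v x => by
    simp [L]
  have hLb : ContMDiffOn 𝓘(ℝ, F) 𝓘(ℝ, Euc m →L[ℝ] Euc m) ∞ (fun p => L fun j => b j p) U :=
    L.contDiff.contMDiff.comp_contMDiffOn (contMDiffOn_pi_space.2 hb)
  have hunit : ∀ p ∈ U, ∃ A : Euc m ≃L[ℝ] Euc m,
      (A : Euc m →L[ℝ] Euc m) = L fun j => b j p := fun p hp => by
    refine exists_continuousLinearEquiv_of_injective _ ((injective_iff_map_eq_zero _).2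
      fun x hx => ?_)
    rw [hL] at hx
    ext j
    exact Fintype.linearIndependent_iff.1 (hli p hp) x hx j
  -- The frame matrix is invertible on `U`, and inversion is smooth at invertible operators.
  have hinv : ContMDiffOn 𝓘(ℝ, F) 𝓘(ℝ, Euc m →L[ℝ] Euc m) ∞
      (fun p => ContinuousLinearMap.inverse (L fun j => b j p)) U := fun p hp => by
    obtain ⟨A, hA⟩ := hunit p hp
    have h1 := contDiffAt_map_inverse (n := ∞) A
    rw [hA] at h1
    exact h1.contMDiffAt.comp_contMDiffWithinAt p (hLb p hp)
  refine ⟨fun j p => ContinuousLinearMap.inverse (L fun j => b j p) (a p) j, fun j => ?_,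
    fun p hp => ?_⟩
  · exact (EuclideanSpace.proj (𝕜 := ℝ) j).contDiff.contMDiff.comp_contMDiffOn (hinv.clm_apply ha)
  · rw [← hL]
    obtain ⟨A, hA⟩ := hunit p hp
    rw [← hA, ContinuousLinearMap.inverse_equiv]
    simp

/-! ### Horizontal lifts and the generalized Hamilton-Jacobi problem on a phase space -/

section PhaseSpace

variable {m n : ℕ} {M E : Type*} [TopologicalSpace M] [ChartedSpace (Euc m) M]
  [IsManifold (𝓡 m) ∞ M] [TopologicalSpace E] [ChartedSpace (Euc (m + n)) E] {π : E → M}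
  {F P : Type*} [NormedAddCommGroup F] [NormedSpace ℝ F]
  [TopologicalSpace P] [ChartedSpace F P]

/-- The horizontal lift of tangent vectors of `M` defined by an integrable transverse distribution;
it annihilates a form if the integral sections satisfy the corresponding field equation. -/
theorem TangentDistribution.exists_horizontalLift [FiniteDimensional ℝ F]
    [IsManifold 𝓘(ℝ, F) ∞ P] [T2Space P] {ρ : P → M} (hρ : ContMDiff 𝓘(ℝ, F) (𝓡 m) ∞ ρ)
    {D : TangentDistribution F P} (hD : D.IsIntegrable m) (ht : D.IsTransverse (m := m) ρ)
    {Ω : DiffForm F P (m + 1)}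
    (hΩ : ∀ (U : Set M) (ψ : M → P), IsLocalSection (m := m) (F := F) ρ U ψ →
      D.IsIntegralSection (m := m) U ψ → SolvesFieldEquation (m := m) Ω U ψ) (p : P) :
    ∃ S : Euc m →ₗ[ℝ] TangentSpace 𝓘(ℝ, F) p, Injective S ∧
      (∀ v, S v ∈ D p) ∧ (∀ w ∈ D p, S (mfderiv 𝓘(ℝ, F) (𝓡 m) ρ p w) = w) ∧
      ∀ (w : TangentSpace 𝓘(ℝ, F) p) (v : Fin m → Euc m),
        Ω p (Fin.cons w fun i => S (v i)) = 0 := by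
  obtain ⟨U, ψ, hψ, hψD, hx, hp⟩ := hD.exists_isIntegralSection hρ ht p
  -- The base point becomes a variable so that `p` can be replaced by `ψ x`.
  generalize ρ p = x at hx hp
  subst hp
  refine ⟨(mfderiv (𝓡 m) 𝓘(ℝ, F) ψ x).toLinearMap,
    LeftInverse.injective (g := fun w => mfderiv 𝓘(ℝ, F) (𝓡 m) ρ (ψ x) w)
      (hψ.mfderiv_comp (hρ.mdifferentiable (by simp)) hx), fun v => (hψD x hx).le ⟨v, rfl⟩,
    fun w hw => ?_, fun w v => ?_⟩
  · obtain ⟨v, rfl⟩ := (hψD x hx).ge hw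
    exact congrArg (mfderiv (𝓡 m) 𝓘(ℝ, F) ψ x)
      (hψ.mfderiv_comp (hρ.mdifferentiable (by simp)) hx v)
  -- The field equation is stated for global smooth fields, so `w` is first realised as the value of
  -- one.
  · obtain ⟨X, hX, rfl⟩ := VField.exists_smooth_apply_eq (ψ x) w
    exact hΩ U ψ hψ hψD X hX x hx v

/-- The horizontal lift of a locally decomposable multivector field is locally decomposable. -/
theorem MVField.IsLocallyDecomposable.horizontalLift [IsManifold (𝓡 (m + n)) ∞ E]
    [IsManifold 𝓘(ℝ, F) ∞ P] (hπ : ContMDiff (𝓡 (m + n)) (𝓡 m) ∞ π)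
    {r : P → E} (hr : ContMDiff 𝓘(ℝ, F) (𝓡 (m + n)) ∞ r)
    {D : TangentDistribution F P} (hD : D.HasRank m) (ht : D.IsTransverse (m := m) (π ∘ r))
    {S : ∀ p : P, Euc m →ₗ[ℝ] TangentSpace 𝓘(ℝ, F) p}
    (hS : ∀ p, ∀ w ∈ D p, S p (mfderiv 𝓘(ℝ, F) (𝓡 m) (π ∘ r) p w) = w)
    {X : MVField (Euc (m + n)) E m} (hX : X.IsLocallyDecomposable) :
    MVField.IsLocallyDecomposable (F := F) (N := P) fun p => exteriorPower.map m
      (S p ∘ₗ (mfderiv (𝓡 (m + n)) (𝓡 m) π (r p)).toLinearMap) (X (r p)) := by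
  intro p₀
  obtain ⟨U, Y, hU, hpU, hY, hXY⟩ := hX (r p₀)
  obtain ⟨U', Z, hU', hpU', hZ, hDZ⟩ := hD p₀
  have hρ : ContMDiff 𝓘(ℝ, F) (𝓡 m) ∞ (π ∘ r) := hπ.comp hr
  -- Vectors projected to `M` lie in varying tangent spaces; composing with `c` turns them into `Euc
  -- m`-valued maps whose smoothness can be stated.
  set c := chartAt (Euc m) (π (r p₀))
  have hVE : IsOpen (U ∩ π ⁻¹' c.source) := hU.inter (c.open_source.preimage hπ.continuous)
  set V := U' ∩ r ⁻¹' (U ∩ π ⁻¹' c.source)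
  have hVo : IsOpen V := hU'.inter (hVE.preimage hr.continuous)
  have hcρ : ContMDiffOn 𝓘(ℝ, F) 𝓘(ℝ, Euc m) ∞ (c ∘ (π ∘ r)) V :=
    contMDiffOn_chart.comp hρ.contMDiffOn fun p hp => hp.2.2
  have hcπ : ContMDiffOn (𝓡 (m + n)) 𝓘(ℝ, Euc m) ∞ (c ∘ π) (U ∩ π ⁻¹' c.source) :=
    contMDiffOn_chart.comp hπ.contMDiffOn fun p hp => hp.2
  have hcm := mdifferentiable_chart (I := 𝓡 m) (π (r p₀))
  have hdρ : ∀ p ∈ V, mfderiv 𝓘(ℝ, F) 𝓘(ℝ, Euc m) (c ∘ (π ∘ r)) p =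
      (mfderiv (𝓡 m) (𝓡 m) c (π (r p))).comp (mfderiv 𝓘(ℝ, F) (𝓡 m) (π ∘ r) p) := fun p hp =>
    mfderiv_comp p (hcm.mdifferentiableAt hp.2.2) (hρ.mdifferentiable (by simp) p)
  have hdπ : ∀ p ∈ V, mfderiv (𝓡 (m + n)) 𝓘(ℝ, Euc m) (c ∘ π) (r p) =
      (mfderiv (𝓡 m) (𝓡 m) c (π (r p))).comp (mfderiv (𝓡 (m + n)) (𝓡 m) π (r p)) := fun p hp =>
    mfderiv_comp (r p) (hcm.mdifferentiableAt hp.2.2) (hπ.mdifferentiable (by simp) (r p))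
  have hinj : ∀ p ∈ V, Injective (mfderiv (𝓡 m) (𝓡 m) c (π (r p))) := fun p hp =>
    (hcm.mfderiv hp.2.2).injective
  have hb : ∀ j, ContMDiffOn 𝓘(ℝ, F) 𝓘(ℝ, Euc m) ∞
      (fun p => (mfderiv 𝓘(ℝ, F) 𝓘(ℝ, Euc m) (c ∘ (π ∘ r)) p (Z j p) : Euc m)) V := fun j =>
    VField.SmoothOn.mfderiv_apply ((hZ j).mono inter_subset_left) hVo hcρ
  have ha : ∀ i, ContMDiffOn 𝓘(ℝ, F) 𝓘(ℝ, Euc m) ∞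
      (fun p => (mfderiv (𝓡 (m + n)) 𝓘(ℝ, Euc m) (c ∘ π) (r p) (Y i (r p)) : Euc m)) V := fun i =>
    (VField.SmoothOn.mfderiv_apply ((hY i).mono inter_subset_left) hVE hcπ).comp
      hr.contMDiffOn fun p hp => hp.2
  -- By transversality, projection to `M` keeps the frame `Z` of the distribution independent.
  have hli : ∀ p ∈ V, LinearIndependent ℝ
      fun j => (mfderiv 𝓘(ℝ, F) 𝓘(ℝ, Euc m) (c ∘ (π ∘ r)) p (Z j p) : Euc m) := by
    intro p hp
    refine (hDZ p hp.1).1.map (f := (mfderiv 𝓘(ℝ, F) 𝓘(ℝ, Euc m) (c ∘ (π ∘ r)) p).toLinearMap) ?_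
    rw [← (hDZ p hp.1).2, Submodule.disjoint_def]
    intro w hw hw0
    refine Submodule.disjoint_def.1 (ht p) w hw (hinj p hp ?_)
    have h1 : mfderiv 𝓘(ℝ, F) 𝓘(ℝ, Euc m) (c ∘ (π ∘ r)) p w = 0 := hw0
    rw [hdρ p hp] at h1
    exact h1.trans (map_zero _).symm
  -- `a i j` are the coefficients of the projection of `Y i` in the projected frame `Z`.
  choose a hasm hasum using fun i => exists_smooth_coefficients hb hli (ha i)
  refine ⟨V, fun i p => ∑ j, a i j p • Z j p, hVo, ⟨hpU', hpU, mem_chart_source _ _⟩,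
    fun i => ?_, fun p hp => ?_⟩
  · exact ContMDiffOn.sum_section fun j _ =>
      (hasm i j).smul_section ((hZ j).mono inter_subset_left)
  · dsimp only
    rw [hXY _ hp.2.1, exteriorPower.map_apply_ιMulti]
    congr 1
    funext i
    -- This combination lies in `D p` and has the same projection to `M` as `Y i (r p)`, so it is
    -- the horizontal lift of that projection.
    have hmem : ∑ j, a i j p • Z j p ∈ D p := by
      rw [(hDZ p hp.1).2]
      exact sum_mem fun j _ => Submodule.smul_mem _ _ (Submodule.subset_span ⟨j, rfl⟩)
    rw [← hS p _ hmem]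
    refine congrArg (S p) (hinj p hp ?_)
    have h1 : mfderiv 𝓘(ℝ, F) 𝓘(ℝ, Euc m) (c ∘ (π ∘ r)) p (∑ j, a i j p • Z j p) =
        mfderiv (𝓡 (m + n)) 𝓘(ℝ, Euc m) (c ∘ π) (r p) (Y i (r p)) := by
      rw [map_sum]
      simp only [map_smul]
      exact hasum i p hp
    rw [hdρ p hp, hdπ p hp] at h1
    exact h1.symm

/-- A solution of the generalized Hamilton-Jacobi problem maps a distribution on `E` onto the
distribution on the phase space along its image. -/
theorem GenHJCondition.map_mfderiv_eq (hπ : ContMDiff (𝓡 (m + n)) (𝓡 m) ∞ π)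
    {D : TangentDistribution (Euc (m + n)) E} (hD : D.IsIntegrable m)
    (hDt : D.IsTransverse (m := m) π) {DP : TangentDistribution F P} {σ : E → P}
    (hσ : ContMDiff (𝓡 (m + n)) 𝓘(ℝ, F) ∞ σ) (h : GenHJCondition π D DP σ) (u : E) :
    (D u).map (mfderiv (𝓡 (m + n)) 𝓘(ℝ, F) σ u).toLinearMap = DP (σ u) := by
  obtain ⟨U, γ, hγ, hγD, hx, hu⟩ := hD.exists_isIntegralSection hπ hDt u
  have h1 := h U γ hγ hγD _ hx
  generalize π u = x at hx hu h1
  subst hu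
  have hγx : MDifferentiableAt (𝓡 m) (𝓡 (m + n)) γ x :=
    (hγ.smooth.contMDiffAt (hγ.isOpen.mem_nhds hx)).mdifferentiableAt (by simp)
  -- The ranges of `Tγ` and `T(σ ∘ γ)` are `D` and `DP`, so the chain rule says that `Tσ` maps one
  -- onto the other.
  rw [mfderiv_comp x (hσ.mdifferentiable (by simp) (γ x)) hγx] at h1
  rw [← hγD x hx]
  refine Eq.trans ?_ h1
  exact (LinearMap.range_comp _ _).symm

/-- The generalized Hamilton-Jacobi problem on a phase space `P` fibred over `E`. -/
theorem GenHJCondition.exists_multivectorField [IsManifold (𝓡 (m + n)) ∞ E]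
    [FiniteDimensional ℝ F] [IsManifold 𝓘(ℝ, F) ∞ P] [T2Space P]
    (hπ : ContMDiff (𝓡 (m + n)) (𝓡 m) ∞ π)
    {D : TangentDistribution (Euc (m + n)) E} (hD : D.IsIntegrable m)
    (hDt : D.IsTransverse (m := m) π)
    {r : P → E} (hr : ContMDiff 𝓘(ℝ, F) (𝓡 (m + n)) ∞ r)
    {σ : E → P} (hσ : ContMDiff (𝓡 (m + n)) 𝓘(ℝ, F) ∞ σ) (hrσ : ∀ u, r (σ u) = u)
    {DP : TangentDistribution F P} (hDP : DP.HasRank m) (hDPi : DP.IsIntegrable m)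
    (hDPt : DP.IsTransverse (m := m) (π ∘ r)) {Ω : DiffForm F P (m + 1)}
    (hΩ : ∀ (U : Set M) (ψ : M → P), IsLocalSection (m := m) (F := F) (π ∘ r) U ψ →
      DP.IsIntegralSection (m := m) U ψ → SolvesFieldEquation (m := m) Ω U ψ)
    (h : GenHJCondition π D DP σ) :
    (∀ X : MVField (Euc (m + n)) E m, X.IsAssociated D → ∃ XP : MVField F P m,
      XP.IsAssociated DP ∧ ContractionVanishes XP Ω ∧
      ∀ u, exteriorPower.map m (mfderiv 𝓘(ℝ, F) (𝓡 (m + n)) r (σ u)).toLinearMap (XP (σ u)) =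
        X (r (σ u))) ∧
    ∀ u, (DP (σ u)).map (mfderiv 𝓘(ℝ, F) (𝓡 (m + n)) r (σ u)).toLinearMap = D (r (σ u)) := by
  have hr' := hr.mdifferentiable (by simp)
  have hσ' := hσ.mdifferentiable (by simp)
  have hπ' := hπ.mdifferentiable (by simp)
  -- The lifts are chosen pointwise; smoothness is recovered from `hS`, which determines the lift by
  -- projection and membership in `DP`.
  choose S hSinj hSD hS hSΩ using DP.exists_horizontalLift (hπ.comp hr) hDPi hDPt hΩ
  have hrσ' : ∀ (u : E) (v : Euc (m + n)),
      (mfderiv 𝓘(ℝ, F) (𝓡 (m + n)) r (σ u) (mfderiv (𝓡 (m + n)) 𝓘(ℝ, F) σ u v) :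
        Euc (m + n)) = v := by
    intro u v
    have h1 := ((hr' (σ u)).hasMFDerivAt.comp u (hσ' u).hasMFDerivAt)
    rw [show r ∘ σ = id from funext hrσ] at h1
    exact DFunLike.congr_fun (hasMFDerivAt_unique h1 (hasMFDerivAt_id u)) v
  -- `r (σ u) = u` is only propositional, so the two subspaces are compared inside the common model
  -- space.
  have hDr : ∀ u, @Eq (Submodule ℝ (Euc (m + n))) (D (r (σ u))) (D u) := fun u => by
    have h1 : ∀ u', u' = u → @Eq (Submodule ℝ (Euc (m + n))) (D u') (D u) := by
      rintro _ rfl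
      rfl
    exact h1 _ (hrσ u)
  -- `Tr ∘ S ∘ Tπ` is the identity on `D`: the vector `Tσ v` lies in `DP` over `Tπ v`, so it is the
  -- lift, and `Tr ∘ Tσ = id`.
  have hlift : ∀ (u : E) (v : Euc (m + n)), v ∈ (D (r (σ u)) : Submodule ℝ (Euc (m + n))) →
      (mfderiv 𝓘(ℝ, F) (𝓡 (m + n)) r (σ u) (S (σ u)
        (mfderiv (𝓡 (m + n)) (𝓡 m) π (r (σ u)) v)) : Euc (m + n)) = v := by
    intro u v hv
    rw [hDr] at hv
    have h1 : mfderiv (𝓡 (m + n)) 𝓘(ℝ, F) σ u v ∈ DP (σ u) :=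
      (h.map_mfderiv_eq hπ hD hDt hσ u).le ⟨v, hv, rfl⟩
    have h2 := hS _ _ h1
    rw [mfderiv_comp (σ u) (hπ' (r (σ u))) (hr' (σ u))] at h2
    have h3 : S (σ u) (mfderiv (𝓡 (m + n)) (𝓡 m) π (r (σ u))
        (mfderiv 𝓘(ℝ, F) (𝓡 (m + n)) r (σ u) (mfderiv (𝓡 (m + n)) 𝓘(ℝ, F) σ u v))) =
        mfderiv (𝓡 (m + n)) 𝓘(ℝ, F) σ u v := h2
    rw [hrσ'] at h3
    rw [h3, hrσ']
  refine ⟨fun X hX => ⟨fun p => exteriorPower.map m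
      (S p ∘ₗ (mfderiv (𝓡 (m + n)) (𝓡 m) π (r p)).toLinearMap) (X (r p)), ⟨fun p => ?_,
      hX.locallyDecomposable.horizontalLift hπ hr hDP hDPt hS, fun p => ?_⟩, fun p w => ?_,
      fun u => ?_⟩, fun u => ?_⟩
  · refine exteriorPower_map_ne_zero (hX.mem (r p)) (hX.ne_zero _) _ ?_
    refine Submodule.disjoint_def.2 fun w hw hw0 => Submodule.disjoint_def.1 (hDt (r p)) w hw ?_
    exact hSinj p (hw0.trans (map_zero _).symm)
  · exact exteriorPower_map_mem_range
      (S p ∘ₗ (mfderiv (𝓡 (m + n)) (𝓡 m) π (r p)).toLinearMap) (fun w => hSD p _) _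
  · exact alternatingMapLinearEquiv_map_eq_zero _ _ (fun v => hSΩ p w _) _
  · rw [← LinearMap.comp_apply, ← exteriorPower.map_comp]
    exact exteriorPower_map_eq_self (hX.mem _) _ (hlift u)
  -- For one inclusion every vector of `D` is the image of its lift; for the other, every vector of
  -- `DP (σ u)` is `Tσ v` with `v` in `D u`.
  · refine le_antisymm ?_ fun v hv => ⟨_, hSD _ _, hlift u v hv⟩
    rw [← h.map_mfderiv_eq hπ hD hDt hσ u]
    rintro _ ⟨_, ⟨v, hv, rfl⟩, rfl⟩
    refine (hDr u).ge ?_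
    have h1 := hrσ' u v
    exact h1.symm ▸ hv

end PhaseSpace

/-! ### The projection of a family of fibres and the Hausdorff property of its total space -/

namespace FibreCharts

variable {B : Type*} [TopologicalSpace B] {V W : Type*} [NormedAddCommGroup V]
  [NormedSpace ℝ V] [NormedAddCommGroup W] [NormedSpace ℝ W] {Z : B → Type*}
  (c : FibreCharts V W Z)

/-- In a chart of the total space the projection is the first coordinate followed by the inverse of
the base chart, so only smoothness of those inverses for the given structure on `B` is required. -/
theorem contMDiff_proj {G : Type*} [NormedAddCommGroup G] [NormedSpace ℝ G] [ChartedSpace G B]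
    (hc : ∀ i, ContMDiffOn 𝓘(ℝ, V) 𝓘(ℝ, G) ∞ (c.base i).symm (c.base i).target) :
    let _ := c.core.toTopologicalSpace
    let _ := c.core.toChartedSpace
    ContMDiff 𝓘(ℝ, V × W) 𝓘(ℝ, G) ∞ (Bundle.TotalSpace.proj : Bundle.TotalSpace W Z → B) := by
  intro _ _
  have _ : IsManifold 𝓘(ℝ, V × W) ∞ (Bundle.TotalSpace W Z) := c.isManifold
  intro p
  have hs : (chartAt (V × W) p).source ∈ 𝓝 p :=
    (chartAt (V × W) p).open_source.mem_nhds (mem_chart_source _ p)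
  have hfst : ∀ q ∈ (chartAt (V × W) p).source,
      (chartAt (V × W) p q).1 = c.base p.proj q.proj := by
    rintro ⟨u, a⟩ hq
    exact congrArg Prod.fst (c.chart_apply p.proj a hq)
  have h1 : ContMDiffOn 𝓘(ℝ, V × W) 𝓘(ℝ, V) ∞ (fun q => (chartAt (V × W) p q).1)
      (chartAt (V × W) p).source :=
    contDiff_fst.contMDiff.comp_contMDiffOn contMDiffOn_chart
  refine (((hc p.proj).comp h1 fun q hq => ?_).congr fun q hq => ?_).contMDiffAt hs
  · rw [mem_preimage, hfst q hq]
    exact (c.base p.proj).map_source hq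
  · rw [comp_apply, hfst q hq]
    exact ((c.base p.proj).left_inv hq).symm

/-- Points in different fibres are separated in `B`. Points of the same fibre lie in a common chart,
since chart domains are full preimages of open sets of `B`. -/
theorem t2Space [T2Space B] :
    let _ := c.core.toTopologicalSpace
    Continuous (Bundle.TotalSpace.proj : Bundle.TotalSpace W Z → B) →
      T2Space (Bundle.TotalSpace W Z) := by
  intro _ hproj
  let _ := c.core.toChartedSpace
  refine ⟨fun p q hpq => ?_⟩
  by_cases h : p.proj = q.proj
  · have hp := mem_chart_source (V × W) p
    have hq : q ∈ (chartAt (V × W) p).source := by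
      change q.proj ∈ (c.base p.proj).source
      exact h ▸ c.mem_base p.proj
    obtain ⟨s, t, hs, ht, hps, hqt, hst⟩ :=
      t2_separation ((chartAt (V × W) p).injOn.ne hp hq hpq)
    exact ⟨_, _, (chartAt (V × W) p).isOpen_inter_preimage hs,
      (chartAt (V × W) p).isOpen_inter_preimage ht, ⟨hp, hps⟩, ⟨hq, hqt⟩,
      (hst.preimage _).mono inter_subset_right inter_subset_right⟩
  · obtain ⟨s, t, hs, ht, hps, hqt, hst⟩ := t2_separation h
    exact ⟨_, _, hs.preimage hproj, ht.preimage hproj, hps, hqt, hst.preimage _⟩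

end FibreCharts

/-! ### Smooth projections and Hausdorff property of the jet bundle and its dual -/

section Projections

variable {m n : ℕ} {M E : Type*} [TopologicalSpace M] [ChartedSpace (Euc m) M]
  [TopologicalSpace E] [ChartedSpace (Euc (m + n)) E] {π : E → M} [hπ : IsFibredManifold m n π]

theorem IsFibredManifold.contMDiff : ContMDiff (𝓡 (m + n)) (𝓡 m) ∞ π := fun u =>
  (hπ.submersion u).contMDiffAt

theorem Jet.contMDiff_toE :
    ContMDiff 𝓘(ℝ, JetSpace m n) (𝓡 (m + n)) ∞ (Jet.toE : Jet m n π → E) :=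
  (jetCharts m n π).contMDiff_proj (contMDiffOn_adapted_symm m n π)

theorem Dual.contMDiff_toE :
    ContMDiff 𝓘(ℝ, DualSpace m n) (𝓡 (m + n)) ∞ (Dual.toE : Dual m n π → E) :=
  (dualCharts m n π).contMDiff_proj (contMDiffOn_adapted_symm m n π)

instance [T2Space E] : T2Space (Jet m n π) :=
  (jetCharts m n π).t2Space Jet.contMDiff_toE.continuous

instance [T2Space E] : T2Space (Dual m n π) :=
  (dualCharts m n π).t2Space Dual.contMDiff_toE.continuous

end Projections

end FieldHJ

end

/-! ### The Lagrangian and Hamiltonian Hamilton-Jacobi theorems -/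

theorem mainTheorem8 {m n : ℕ} {M E : Type*}
    [TopologicalSpace M] [ChartedSpace (EuclideanSpace ℝ (Fin m)) M] [IsManifold (𝓡 m) ∞ M]
    [T2Space M] [SecondCountableTopology M]
    [TopologicalSpace E] [ChartedSpace (EuclideanSpace ℝ (Fin (m + n))) E]
    [IsManifold (𝓡 (m + n)) ∞ E] [T2Space E] [SecondCountableTopology E]
    (π : E → M) [IsFibredManifold m n π]
    (η : DiffForm (Euc m) M m) (hη : IsVolumeForm η)
    (D : TangentDistribution (Euc (m + n)) E)
    (hD : D.HasRank m) (hDint : D.IsIntegrable m) (hDtrans : D.IsTransverse (m := m) π) :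
    (∀ (L : Jet m n π → ℝ)
      (DL : TangentDistribution (JetSpace m n) (Jet m n π))
      (Ψ : ∀ u, JetFibre m n π u),
      ContMDiff 𝓘(ℝ, JetSpace m n) 𝓘(ℝ, ℝ) ∞ L →
      IsLagrangianSolution η L DL →
      ContMDiff (𝓡 (m + n)) 𝓘(ℝ, JetSpace m n) ∞ (fun u => Jet.mk u (Ψ u)) →
      GenHJCondition π D DL (fun u => Jet.mk u (Ψ u)) →
      (∀ X : MVField (Euc (m + n)) E m, X.IsAssociated D →
        ∃ XL : MVField (JetSpace m n) (Jet m n π) m,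
          XL.IsAssociated DL ∧ ContractionVanishes XL (cartanMultisymplecticForm η L) ∧
          ∀ u, X u = exteriorPower.map m
            (mfderiv 𝓘(ℝ, JetSpace m n) (𝓡 (m + n)) Jet.toE
              (Jet.mk u (Ψ u))).toLinearMap (XL (Jet.mk u (Ψ u)))) ∧
      ∀ u, D u = (DL (Jet.mk u (Ψ u))).map
        (mfderiv 𝓘(ℝ, JetSpace m n) (𝓡 (m + n)) Jet.toE
          (Jet.mk u (Ψ u))).toLinearMap) ∧
    (∀ (h : Dual m n π → ExtDual m n π)
      (Dh : TangentDistribution (DualSpace m n) (Dual m n π))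
      (s : ∀ u, DualFibre m n π u),
      IsHamiltonianSection h →
      IsHamiltonianSolution h Dh →
      ContMDiff (𝓡 (m + n)) 𝓘(ℝ, DualSpace m n) ∞ (fun u => Dual.mk u (s u)) →
      GenHJCondition π D Dh (fun u => Dual.mk u (s u)) →
      (∀ X : MVField (Euc (m + n)) E m, X.IsAssociated D →
        ∃ Xh : MVField (DualSpace m n) (Dual m n π) m,
          Xh.IsAssociated Dh ∧ ContractionVanishes Xh (hamiltonCartanMultisymplecticForm h) ∧
          ∀ u, X u = exteriorPower.map m
            (mfderiv 𝓘(ℝ, DualSpace m n) (𝓡 (m + n)) Dual.toE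
              (Dual.mk u (s u))).toLinearMap (Xh (Dual.mk u (s u)))) ∧
      ∀ u, D u = (Dh (Dual.mk u (s u))).map
        (mfderiv 𝓘(ℝ, DualSpace m n) (𝓡 (m + n)) Dual.toE
          (Dual.mk u (s u))).toLinearMap) := by
  have hπs : ContMDiff (𝓡 (m + n)) (𝓡 m) ∞ π := IsFibredManifold.contMDiff
  refine ⟨fun L DL Ψ _ hDL hΨ h => ?_, fun H Dh s _ hDh hs h => ?_⟩
  -- Here `P` is the jet bundle. The projection of `Jet.mk u (Ψ u)` is `u` by definition, and the
  -- field equation for `ψ` is the last component of the Lagrangian condition on integral sections.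
  · obtain ⟨h1, h2⟩ := h.exists_multivectorField hπs hDint hDtrans Jet.contMDiff_toE hΨ
      (fun _ => rfl) hDL.hasRank hDL.integrable hDL.transverse
      fun U ψ hψ hψD => (hDL.sections U ψ hψ hψD).choose_spec.2.2
    exact ⟨fun X hX => (h1 X hX).imp fun _ hXL => ⟨hXL.1, hXL.2.1, fun u => (hXL.2.2 u).symm⟩,
      fun u => (h2 u).symm⟩
  · obtain ⟨h1, h2⟩ := h.exists_multivectorField hπs hDint hDtrans Dual.contMDiff_toE hs
      (fun _ => rfl) hDh.hasRank hDh.integrable hDh.transverse hDh.sections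
    exact ⟨fun X hX => (h1 X hX).imp fun _ hXh => ⟨hXh.1, hXh.2.1, fun u => (hXh.2.2 u).symm⟩,
      fun u => (h2 u).symm⟩
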